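/- Let $\mathbb P_n$ be the complex projective space with homogeneous coordinates $X=(X_0,\dots,X_n)$, let $\mathbb P_n'$ be the dual space of hyperplanes with homogeneous coordinates $u=(u_0,\dots,u_n)$, and let $\widetilde{\mathbb P_n}=\{(m,h)\in\mathbb P_n\times\mathbb P_n' : m\in h\}=\{\sum_i u_iX_i=0\}$ be the manifold of contact elements, with projection $\pi:\widetilde{\mathbb P_n}\to\mathbb P_n$. A *$d$-web* on $\mathbb P_n$ ($d\ge 1$) is an analytic subset $W\subset\widetilde{\mathbb P_n}$ of pure dimension $n$ with $\pi(W)=\mathbb P_n$, such that: the contact form $\eta=\sum_i u_i\,dX_i$ satisfies $\eta\wedge d\eta=0$ on the regular part of $W$; the critical set $\Gamma_W$ (the points where $W$ is singular or $d(\pi|_W)$ is not an isomorphism) has dimension at most $n-1$ or is empty; $W$ is a $d$-fold covering above $M_0=\mathbb P_n\setminus\pi(\Gamma_W)$; and every fiber of $W\to\mathbb P_n$ is finite, of degree $d$ counted with multiplicity. Above $M_0$, $W$ consists locally of $d$ disjoint sheets, each defining a foliation of codimension one. A *leaf* of $W$ is a hypersurface which in $M_0$ is locally a leaf of one of these foliations,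 i.e. a smooth hypersurface all of whose tangent contact elements belong to $W$. The web is *algebraic* if its leaves are the hyperplanes belonging to some algebraic curve $C\subset\mathbb P_n'$ (of pure dimension one) of degree $d$, that is: every connected piece of leaf in $M_0$ lies in a hyperplane belonging to $C$, and every hyperplane belonging to $C$ is a leaf, in the sense that its part in $M_0$ (possibly empty) is locally a leaf. A *global PDE* $S$ of weight $d\ge 1$ and bi-degree $(\delta,d)$ is the hypersurface $\{H=0\}$ of $\widetilde{\mathbb P_n}$ defined by a polynomial $H(X;u)$ homogeneous of degree $\delta$ in $X$ and of degree $d$ in $u$, whose local equation is reduced and such that the germs at any point of $\mathbb P_n$ of the coefficients of the corresponding differential operator are relatively prime. A $d$-web $W$ is a *CI-web* defined by the global PDEs $S_1,\dots,S_{n-1}$, of bi-degrees $(\delta_\alpha,d_\alpha)$, if $d=\prod_\alpha d_\alpha$, $W=\bigcap_\alpha S_\alpha$, and the ideal of germs of holomorphic functions vanishing on $W$ is generated at each point of $W$ by the germs vanishing on one of the $S_\alpha$. Its *multi-degree* is $(\delta_\alpha)_{1\le\alpha\le n-1}$. **Proposition.** Let $W=\bigcap_{\alpha=1}^{n-1}S_\alpha$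 be a CI-web on $\mathbb P_n$. Then $W$ is algebraic if and only if its multi-degree is zero, i.e. $\delta_\alpha=0$ for all $\alpha$; equivalently, if and only if every $S_\alpha$ has bi-degree $(0,d_\alpha)$. -/

import Mathlib

open scoped LinearAlgebra.Projectivization Topology
open Filter

namespace Webs

noncomputable section

/-! ## Projective space, its dual, and the manifold of contact elements -/

/-- Homogeneous coordinates `(X_0, …, X_n)` (or `(u_0, …, u_n)` on the dual space). -/
abbrev Vec (n : ℕ) : Type := Fin (n + 1) → ℂ

/-- The complex projective space of dimension `n`. The same type is used for the dual projective
space of hyperplanes: `[u]` stands for the hyperplane of equation `∑ u_i X_i = 0`. -/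
abbrev Proj (n : ℕ) : Type := ℙ ℂ (Vec n)

/-- The quotient topology on projective space. -/
instance instTopologicalSpaceProj (n : ℕ) : TopologicalSpace (Proj n) :=
  TopologicalSpace.coinduced
    (fun v : {v : Vec n // v ≠ 0} => Projectivization.mk ℂ v.1 v.2) inferInstance

/-- The manifold of contact elements of projective space: pairs `(m, h)` of a point `m` and a
hyperplane `h` going through `m`. -/
def contactElements (n : ℕ) : Set (Proj n × Proj n) :=
  {w | Projectivization.orthogonal w.1 w.2}

/-- The set of points of the hyperplane `h`. -/
def hyperplane {n : ℕ} (h : Proj n) : Set (Proj n) :=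
  {m | Projectivization.orthogonal m h}

/-- The cone over a subset of a projective space: all its systems of homogeneous coordinates.
Since `Vec n ∖ {0} → Proj n` is a holomorphic principal `ℂˣ`-bundle, local holomorphic notions for
a subset of `Proj n` (analytic set, submanifold, …) are read on its cone, with dimension
raised by `1`. -/
def cone {n : ℕ} (A : Set (Proj n)) : Set (Vec n) :=
  {X | ∃ hX : X ≠ 0, Projectivization.mk ℂ X hX ∈ A}

/-- The cone over a subset of `Proj n × Proj n`: all systems `(X, u)` of homogeneous coordinates
of its points. Local holomorphic notions are read on this cone, with dimension
raised by `2`. -/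
def bicone {n : ℕ} (A : Set (Proj n × Proj n)) : Set (Vec n × Vec n) :=
  {z | ∃ (hX : z.1 ≠ 0) (hu : z.2 ≠ 0),
    (Projectivization.mk ℂ z.1 hX, Projectivization.mk ℂ z.2 hu) ∈ A}

/-! ## Local complex analytic geometry -/

section Local

variable {E : Type*} [NormedAddCommGroup E] [NormedSpace ℂ E]

/-- Near its point `z`, the set `A` is the complex submanifold of codimension `c` with submersive
holomorphic equation `g = 0`. The tangent space of `A` at `z` is then the kernel of
`fderiv ℂ g z`. -/
structure IsSubmersiveEquation (A : Set E) (z : E) {c : ℕ} (g : E → Fin c → ℂ) : Prop where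
  mem : z ∈ A
  analyticAt : AnalyticAt ℂ g z
  surjective : Function.Surjective (fderiv ℂ g z)
  mem_iff : ∀ᶠ y in 𝓝 z, (y ∈ A ↔ g y = 0)

/-- `A` is a complex submanifold of codimension `c` near its point `z`. -/
def IsRegularPoint (A : Set E) (c : ℕ) (z : E) : Prop :=
  ∃ g : E → Fin c → ℂ, IsSubmersiveEquation A z g

/-- An analytic set `A` has pure codimension `c`: the points at which it is a submanifold of
codimension `c` are dense in it. -/
def HasPureCodim (A : Set E) (c : ℕ) : Prop :=
  A ⊆ closure {z | IsRegularPoint A c z}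

/-- Near `z`, the set `A` is defined by finitely many holomorphic equations. -/
def IsAnalyticAt (A : Set E) (z : E) : Prop :=
  ∃ (k : ℕ) (g : E → Fin k → ℂ), AnalyticAt ℂ g z ∧ ∀ᶠ y in 𝓝 z, (y ∈ A ↔ g y = 0)

/-- The holomorphic germ at `z` of the function `f` vanishes on `A`. -/
def GermVanishesOn (A : Set E) (z : E) (f : E → ℂ) : Prop :=
  AnalyticAt ℂ f z ∧ ∀ᶠ y in 𝓝 z, y ∈ A → f y = 0

end Local

/-- An analytic subset `A` of `Proj n × Proj n` has complex dimension at most `k` (or is empty):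
it is covered by countably many holomorphic images of open subsets of `ℂ ^ k`. (An analytic set
of dimension at most `k` is a countable union of complex submanifolds of dimension at most `k`,
and conversely such countably many images cannot cover a submanifold of dimension larger
than `k`.) -/
def HasDimLE {n : ℕ} (A : Set (Proj n × Proj n)) (k : ℕ) : Prop :=
  ∃ (Ω : ℕ → Set (Fin k → ℂ)) (φ : ℕ → (Fin k → ℂ) → Vec n × Vec n),
    (∀ i, IsOpen (Ω i) ∧ AnalyticOnNhd ℂ (φ i) (Ω i)) ∧
    ∀ w ∈ A, ∃ i, ∃ t ∈ Ω i, ∃ (hX : (φ i t).1 ≠ 0) (hu : (φ i t).2 ≠ 0),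
      w = (Projectivization.mk ℂ (φ i t).1 hX, Projectivization.mk ℂ (φ i t).2 hu)

/-! ## Global webs of codimension one on projective space -/

/-- The value on the tangent vector `a = (dX, du)` of the form `∑ u_i dX_i`, which represents the
tautological contact form in homogeneous coordinates. (On the cone of `contactElements n`, it is
the pull-back of a local contact form, up to a holomorphic unit.) -/
def contactForm {n : ℕ} (z a : Vec n × Vec n) : ℂ := z.2 ⬝ᵥ a.1

/-- The exterior derivative `∑ du_i ∧ dX_i` of the contact form, on the tangent vectors
`a` and `b`. -/
def dContactForm {n : ℕ} (a b : Vec n × Vec n) : ℂ := a.2 ⬝ᵥ b.1 - b.2 ⬝ᵥ a.1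

/-- The contact form `η` satisfies `η ∧ dη = 0` on the regular part of `W` (here `W` has
dimension `n`, so that its cone has codimension `n` in `Vec n × Vec n`). -/
def IsIntegrable {n : ℕ} (W : Set (Proj n × Proj n)) : Prop :=
  ∀ (z : Vec n × Vec n) (g : Vec n × Vec n → Fin n → ℂ), IsSubmersiveEquation (bicone W) z g →
    ∀ a b c : Vec n × Vec n, fderiv ℂ g z a = 0 → fderiv ℂ g z b = 0 → fderiv ℂ g z c = 0 →
      contactForm z a * dContactForm b c + contactForm z b * dContactForm c a +
        contactForm z c * dContactForm a b = 0

/-- At the point of homogeneous coordinates `z`, the set `W` is regular of dimension `n`, and the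
differential of its projection to `Proj n` is an isomorphism. (In homogeneous coordinates: the
first projection maps the tangent space of the cone onto `Vec n`; its kernel is then the line
of the scalings of `u`.) -/
def IsNoncritical {n : ℕ} (W : Set (Proj n × Proj n)) (z : Vec n × Vec n) : Prop :=
  ∃ g : Vec n × Vec n → Fin n → ℂ, IsSubmersiveEquation (bicone W) z g ∧
    ∀ v : Vec n, ∃ a : Vec n × Vec n, fderiv ℂ g z a = 0 ∧ a.1 = v

/-- The critical set of `W`. -/
def criticalSet {n : ℕ} (W : Set (Proj n × Proj n)) : Set (Proj n × Proj n) :=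
  {w | w ∈ W ∧ ¬ IsNoncritical W (w.1.rep, w.2.rep)}

/-- The regular part `M_0` of the web: the complement of the caustic, which is the projection of
the critical set. -/
def regularPart {n : ℕ} (W : Set (Proj n × Proj n)) : Set (Proj n) :=
  (Prod.fst '' criticalSet W)ᶜ

/-- The hyperplanes `h` such that `(m, h)` belongs to `W`. -/
def fiber {n : ℕ} (W : Set (Proj n × Proj n)) (m : Proj n) : Set (Proj n) :=
  {h | (m, h) ∈ W}

/-- The fiber of `W` above `m` has dimension `0`, and degree `d`: it is finite, and has `d` points
when each `h` is counted with its multiplicity `μ h`, the number of points of the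
fibers above the points of the regular part near `m` which are near `h`. -/
def FiberHasDegree {n : ℕ} (W : Set (Proj n × Proj n)) (d : ℕ) (m : Proj n) : Prop :=
  (fiber W m).Finite ∧ ∃ μ : Proj n → ℕ,
    (∀ h, 0 < μ h ↔ h ∈ fiber W m) ∧
    (∀ h, ∀ N ∈ 𝓝 h, ∃ N' ∈ 𝓝 h, N' ⊆ N ∧
      ∀ᶠ m' in 𝓝 m, m' ∈ regularPart W → (fiber W m' ∩ N').encard = μ h) ∧
    ∑ᶠ h, μ h = d

/-- `W` is a (global, codimension one, holomorphic) `d`-web on `Proj n`. -/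
structure IsWeb {n : ℕ} (W : Set (Proj n × Proj n)) (d : ℕ) : Prop where
  one_le : 1 ≤ d
  subset : W ⊆ contactElements n
  /-- `W` is a closed analytic set … -/
  analytic : ∀ z : Vec n × Vec n, z.1 ≠ 0 → z.2 ≠ 0 → IsAnalyticAt (bicone W) z
  /-- … of pure dimension `n`. -/
  pureDim : HasPureCodim (bicone W) n
  surjective : Prod.fst '' W = Set.univ
  integrable : IsIntegrable W
  covering : IsCoveringMapOn (fun w : W => w.1.1) (regularPart W)
  sheets : ∀ m ∈ regularPart W, (fiber W m).encard = d
  critical_dim : HasDimLE (criticalSet W) (n - 1)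
  fiber_degree : ∀ m, FiberHasDegree W d m

/-! ## Global partial differential equations and complete intersection webs -/

/-- The value at `(X, u)` of a polynomial in `X_0, …, X_n` (variables `Sum.inl i`) and
`u_0, …, u_n` (variables `Sum.inr i`). -/
def evalAt {n : ℕ} (H : MvPolynomial (Fin (n + 1) ⊕ Fin (n + 1)) ℂ) (z : Vec n × Vec n) : ℂ :=
  MvPolynomial.eval (Sum.elim z.1 z.2) H

/-- The hypersurface `S` of equations `H = 0` and `∑ u_i X_i = 0` in `contactElements n`. -/
def locusOf {n : ℕ} (H : MvPolynomial (Fin (n + 1) ⊕ Fin (n + 1)) ℂ) : Set (Proj n × Proj n) :=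
  {w | w ∈ contactElements n ∧ evalAt H (w.1.rep, w.2.rep) = 0}

/-- A global first order homogeneous polynomial partial differential equation on `Proj n`, of
weight `d`, given by a polynomial `H(X; u)` which is homogeneous of degree `δ` in `X` and
of degree `d ≥ 1` in `u`. -/
structure GlobalPDE (n : ℕ) where
  /-- the degree in `X` -/
  δ : ℕ
  /-- the weight, which is the degree in `u` -/
  d : ℕ
  /-- the polynomial -/
  H : MvPolynomial (Fin (n + 1) ⊕ Fin (n + 1)) ℂ
  one_le : 1 ≤ d
  homogeneous_left : MvPolynomial.IsWeightedHomogeneous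
    (Sum.elim (fun _ => 1) (fun _ => 0) : Fin (n + 1) ⊕ Fin (n + 1) → ℕ) H δ
  homogeneous_right : MvPolynomial.IsWeightedHomogeneous
    (Sum.elim (fun _ => 0) (fun _ => 1) : Fin (n + 1) ⊕ Fin (n + 1) → ℕ) H d
  /-- The equation of `S` is reduced: any holomorphic germ (on the cone of `contactElements n`)
  which vanishes on `S` is a multiple of `H`. -/
  reduced : ∀ z ∈ bicone (locusOf H), ∀ f : Vec n × Vec n → ℂ,
    GermVanishesOn (bicone (locusOf H)) z f →
      ∃ b : Vec n × Vec n → ℂ, AnalyticAt ℂ b z ∧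
        ∀ᶠ y in 𝓝 z, y ∈ bicone (contactElements n) → f y = b y * evalAt H y
  /-- The germs of the coefficients of the differential operator are relatively prime at any
  point of `Proj n`: a germ of holomorphic function which divides the value of the operator on every
  germ of covector field `ν` (a field of covectors on `Proj n` is given in homogeneous
  coordinates by `ν` with `∑ ν_i(Y) Y_i = 0`) is a unit. -/
  coprime : ∀ X : Vec n, X ≠ 0 → ∀ f : Vec n → ℂ, AnalyticAt ℂ f X →
    (∀ ν : Vec n → Vec n, AnalyticAt ℂ ν X → (∀ᶠ Y in 𝓝 X, ν Y ⬝ᵥ Y = 0) →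
      ∃ g : Vec n → ℂ, AnalyticAt ℂ g X ∧ ∀ᶠ Y in 𝓝 X, evalAt H (Y, ν Y) = f Y * g Y) →
    f X ≠ 0

/-- The hypersurface of contact elements defined by a global PDE. -/
def GlobalPDE.locus {n : ℕ} (S : GlobalPDE n) : Set (Proj n × Proj n) := locusOf S.H

/-- The bi-degree of a global PDE. -/
def GlobalPDE.bidegree {n : ℕ} (S : GlobalPDE n) : ℕ × ℕ := (S.δ, S.d)

/-- `W` is a complete intersection web on `Proj n`, defined by the `n - 1` global PDEs `S α`: it is
a web of weight `∏ d_α`, it is the intersection of the hypersurfaces `S α`, and at each of its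
points the ideal of holomorphic germs (on `contactElements n`) vanishing on `W` is
generated by the germs which vanish on one of the `S α`. -/
structure IsCIWeb {n : ℕ} (W : Set (Proj n × Proj n)) (S : Fin (n - 1) → GlobalPDE n) : Prop where
  isWeb : IsWeb W (∏ α, (S α).d)
  eq_inter : W = {w | w ∈ contactElements n ∧ ∀ α, w ∈ (S α).locus}
  ideal : ∀ z ∈ bicone W, ∀ f : Vec n × Vec n → ℂ, GermVanishesOn (bicone W) z f →
    ∃ F : Fin (n - 1) → Vec n × Vec n → ℂ,
      (∀ α, GermVanishesOn (bicone (S α).locus) z (F α)) ∧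
      ∀ᶠ y in 𝓝 z, y ∈ bicone (contactElements n) → f y = ∑ α, F α y

/-- The multi-degree of the complete intersection web defined by the global PDEs `S α`. -/
def multidegree {n : ℕ} (S : Fin (n - 1) → GlobalPDE n) : Fin (n - 1) → ℕ := fun α => (S α).δ

/-! ## Leaves and algebraic webs -/

/-- The coordinates `(∂f/∂X_0, …, ∂f/∂X_n)` of the differential of `f`. -/
def partialDerivs {n : ℕ} (f : Vec n → ℂ) (X : Vec n) : Vec n :=
  fun i => fderiv ℂ f X (Pi.single i 1)

/-- In the regular part of the web `W`, the set `L` is locally a leaf of one of the local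
foliations defined by `W`: near each of its points in the regular part, it is a smooth
hypersurface `f = 0` all of whose tangent contact elements belong to `W`. (Above a small connected
open set of the regular part, `W` is the disjoint union of `d` sheets, one for each local
foliation, so that the tangent contact elements of this connected piece of hypersurface remain
in one sheet.) -/
def IsLocallyLeaf {n : ℕ} (W : Set (Proj n × Proj n)) (L : Set (Proj n)) : Prop :=
  ∀ X ∈ cone (L ∩ regularPart W), ∃ f : Vec n → ℂ,
    AnalyticAt ℂ f X ∧ fderiv ℂ f X ≠ 0 ∧ (∀ᶠ Y in 𝓝 X, (Y ∈ cone L ↔ f Y = 0)) ∧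
    ∀ᶠ Y in 𝓝 X, f Y = 0 → (Y, partialDerivs f Y) ∈ bicone W

/-- `C` is an algebraic curve of degree `d` in the (dual) projective space: an algebraic set of
pure dimension one (its cone has codimension `n - 1` in `Vec n`) which a generic hyperplane meets
in exactly `d` points. Here `m` runs over `Proj n`, which is the space of hyperplanes of the dual
space: the points of `C` on the hyperplane `m` are the `h ∈ C` with `m ∈ h`. -/
structure IsAlgebraicCurve {n : ℕ} (C : Set (Proj n)) (d : ℕ) : Prop where
  algebraic : ∃ s : Set (MvPolynomial (Fin (n + 1)) ℂ), (∀ p ∈ s, ∃ k, p.IsHomogeneous k) ∧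
    C = {h | ∀ p ∈ s, MvPolynomial.eval h.rep p = 0}
  pureDim : HasPureCodim (cone C) (n - 1)
  degree : ∃ O : Set (Proj n), IsOpen O ∧ Dense O ∧
    ∀ m ∈ O, {h | h ∈ C ∧ m ∈ hyperplane h}.encard = d

/-- `W` is an algebraic `d`-web: a `d`-web whose leaves are the hyperplanes belonging to some
algebraic curve `C` of degree `d` in the dual projective space. Namely, every leaf (or connected
piece of leaf) in the regular part is contained in a hyperplane belonging to `C`, and every
hyperplane belonging to `C` is a leaf. -/
def IsAlgebraicWeb {n : ℕ} (W : Set (Proj n × Proj n)) (d : ℕ) : Prop :=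
  IsWeb W d ∧ ∃ C : Set (Proj n), IsAlgebraicCurve C d ∧
    (∀ L : Set (Proj n), L ⊆ regularPart W → IsConnected L → IsLocallyLeaf W L →
      ∃ h ∈ C, L ⊆ hyperplane h) ∧
    ∀ h ∈ C, IsLocallyLeaf W (hyperplane h)

end

end Webs

/-! Everything is read in homogeneous coordinates `(X, u)`. Above a hyperplane `u`, the contact
elements in `W` are cut out on `{u ⬝ᵥ X = 0}` by the equations `H_α(X; u) = 0`, and the question is
how these depend on `X`.

Suppose `W` is algebraic with curve `C`. Comparing `d`-point fibers on a dense open set, then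
passing to the limit with multiplicities, shows that every hyperplane occurring in `W` lies in `C`
(`IsWeb.snd_mem_curve`). Choose a regular point `u` of the cone of `C` whose hyperplane lies
entirely under `W` (`IsCIWeb.exists_regular_hyperplane`). The `n - 1` local equations of `C` at `u`
vanish on `W`, so by the ideal condition their differentials are combinations of those of the `H_α`
along the contact cone (`IsCIWeb.exists_fderiv_eq_sum`). Hence a square matrix of derivatives of the
`H_α` is invertible at each `X` of the hyperplane. Its determinant is homogeneous in `X` of degree
`∑ δ_α` and has no zero on a projective line, so by Liouville's theorem this degree is `0`
(`degree_eq_zero_of_ne_zero`).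

Conversely, if all `δ_α` vanish, the `H_α` depend on `u` alone and define `C` in the dual space,
with `W = {(X, u) : u ∈ C, u ⬝ᵥ X = 0}`. A rank count carries regular points of `W` to regular
points of `C`, and the fibers over the regular part give its degree. Along a leaf, the tangent
contact element moves inside `W`; since `W` contains every contact element of each of its
hyperplanes, the variation of `u` is a vertical tangent vector, hence only a rescaling at a
noncritical point. The tangent hyperplane is therefore locally constant, and connectedness concludes
(`IsLocallyLeaf.exists_subset_hyperplane`). -/

namespace Webs

variable {n : ℕ}

/-! ### Submersions and tangent spaces -/

section Local

variable {E F G : Type*} [NormedAddCommGroup E] [NormedSpace ℂ E]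
  [NormedAddCommGroup F] [NormedSpace ℂ F] [FiniteDimensional ℂ F]
  [NormedAddCommGroup G] [NormedSpace ℂ G]

/-- Straightening of a submersion: a local parametrization `ψ` of `E` in which `g` is linear,
with local inverse `χ`. -/
theorem exists_straightening [CompleteSpace E] {g : E → F} {z : E} (hg : AnalyticAt ℂ g z)
    (hs : Function.Surjective (fderiv ℂ g z)) (hz : g z = 0) :
    ∃ ψ χ : E → E, ψ 0 = z ∧ HasFDerivAt ψ (ContinuousLinearMap.id ℂ E) 0 ∧
      (∀ᶠ k in 𝓝 0, DifferentiableAt ℂ ψ k) ∧ (∀ᶠ k in 𝓝 0, g (ψ k) = fderiv ℂ g z k) ∧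
      ContinuousAt χ z ∧ χ z = 0 ∧ (∀ᶠ y in 𝓝 z, ψ (χ y) = y) ∧
      ∀ᶠ y in 𝓝 z, fderiv ℂ g z (χ y) = g y := by
  set T := fderiv ℂ g z with hT
  obtain ⟨R, hR⟩ : ∃ R : F →L[ℂ] E, ∀ v, T (R v) = v := by
    obtain ⟨R, hR⟩ := T.toLinearMap.exists_rightInverse_of_surjective
      (LinearMap.range_eq_top.2 hs)
    exact ⟨LinearMap.toContinuousLinearMap R, fun v => LinearMap.congr_fun hR v⟩
  -- `T ∘ Φ = g` because `T ∘ R = 1`, and the derivative of `Φ` at `z` is the identity, so `ψ` and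
  -- `χ` come from the inverse function theorem.
  set Φ : E → E := fun y => y + R (g y - T y) with hΦdef
  have hΦa : ContDiffAt ℂ 1 Φ z := by
    have hg1 : ContDiffAt ℂ 1 g z := hg.contDiffAt
    exact contDiffAt_id.add (R.contDiff.contDiffAt.comp z (hg1.sub T.contDiff.contDiffAt))
  have hΦd : HasFDerivAt Φ (ContinuousLinearEquiv.refl ℂ E : E →L[ℂ] E) z := by
    have h1 : HasFDerivAt Φ (ContinuousLinearMap.id ℂ E + R.comp (T - T)) z :=
      (hasFDerivAt_id z).add
        (R.hasFDerivAt.comp z (hg.differentiableAt.hasFDerivAt.sub T.hasFDerivAt))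
    convert h1 using 1
    ext v
    simp
  have hTΦ : ∀ y, T (Φ y) = g y := fun y => by simp [hΦdef, hR]
  have hst := hΦa.hasStrictFDerivAt' hΦd one_ne_zero
  set θ := hst.localInverse with hθ
  have hθz : θ (Φ z) = z := hst.localInverse_apply_image
  have hcd : ContDiffAt ℂ 1 θ (Φ z) := hΦa.to_localInverse hΦd one_ne_zero
  have hTz : T (Φ z) = 0 := by rw [hTΦ, hz]
  have htend : Tendsto (fun k => Φ z + k) (𝓝 0) (𝓝 (Φ z)) := by
    have : Continuous (fun k => Φ z + k) := by fun_prop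
    simpa using this.tendsto 0
  refine ⟨fun k => θ (Φ z + k), fun y => Φ y - Φ z, by simp [hθz], ?_, ?_, ?_, ?_, by simp, ?_, ?_⟩
  · have h1 : HasFDerivAt θ (ContinuousLinearMap.id ℂ E) (Φ z + 0) := by
      rw [add_zero]; exact hst.to_localInverse.hasFDerivAt
    exact h1.comp (f := fun k => Φ z + k) 0 ((hasFDerivAt_id (0 : E)).const_add (Φ z))
  · have h1 : ∀ᶠ y in 𝓝 (Φ z), DifferentiableAt ℂ θ y :=
      (hcd.eventually (by simp)).mono fun y hy => hy.differentiableAt one_ne_zero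
    filter_upwards [htend.eventually h1] with k hk
    exact hk.comp (f := fun k => Φ z + k) k (by fun_prop)
  · filter_upwards [htend.eventually hst.eventually_right_inverse] with k hk
    rw [← hTΦ, hk, map_add, hTz, zero_add]
  · exact hΦa.continuousAt.sub continuousAt_const
  · filter_upwards [hst.eventually_left_inverse] with y hy
    simpa using hy
  · exact .of_forall fun y => by rw [map_sub, hTΦ, hTz, sub_zero]

/-- A function vanishing on a submanifold has a differential vanishing on its tangent space. -/
theorem fderiv_eq_zero_of_vanishing [CompleteSpace E] {g : E → F} {z : E} (hg : AnalyticAt ℂ g z)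
    (hs : Function.Surjective (fderiv ℂ g z)) (hz : g z = 0) {f : E → G}
    (hf : DifferentiableAt ℂ f z) (hv : ∀ᶠ y in 𝓝 z, g y = 0 → f y = 0) {v : E}
    (hgv : fderiv ℂ g z v = 0) : fderiv ℂ f z v = 0 := by
  -- For `v` in the kernel, the curve `t ↦ ψ (t • v)` stays in `g = 0` and has velocity `v` at `0`.
  obtain ⟨ψ, -, h0, hd, -, hgψ, -⟩ := exists_straightening hg hs hz
  have hline : Tendsto (fun t : ℂ => t • v) (𝓝 0) (𝓝 0) := by
    have : Continuous (fun t : ℂ => t • v) := by fun_prop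
    simpa using this.tendsto 0
  have hψc : Tendsto ψ (𝓝 0) (𝓝 z) := by
    have := hd.continuousAt.tendsto
    rwa [h0] at this
  have hzero : (fun t : ℂ => f (ψ (t • v))) =ᶠ[𝓝 0] fun _ => 0 := by
    filter_upwards [hline.eventually hgψ, hline.eventually (hψc.eventually hv)] with t h1 h2
    exact h2 (by rw [h1, map_smul, hgv, smul_zero])
  have hl : HasDerivAt (fun t : ℂ => t • v) v 0 := by
    simpa using (hasDerivAt_id (0 : ℂ)).smul_const v
  have hd' : HasFDerivAt ψ (ContinuousLinearMap.id ℂ E) ((0 : ℂ) • v) := by rwa [zero_smul]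
  have hc : HasDerivAt (fun t : ℂ => ψ (t • v)) v 0 :=
    HasFDerivAt.comp_hasDerivAt (f := fun t : ℂ => t • v) 0 hd' hl
  have hf' : HasFDerivAt f (fderiv ℂ f z) (ψ ((0 : ℂ) • v)) := by
    rw [zero_smul, h0]; exact hf.hasFDerivAt
  have hc2 : HasDerivAt (fun t : ℂ => f (ψ (t • v))) (fderiv ℂ f z v) 0 :=
    HasFDerivAt.comp_hasDerivAt (f := fun t : ℂ => ψ (t • v)) 0 hf' hc
  exact hc2.unique ((hasDerivAt_const (0 : ℂ) (0 : G)).congr_of_eventuallyEq hzero)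

/-- Surjectivity is an open condition on continuous linear maps with finite dimensional target. -/
theorem eventually_surjective {X : Type*} [TopologicalSpace X] {A : X → E →L[ℂ] F} {x : X}
    (hA : ContinuousAt A x) (hs : Function.Surjective (A x)) :
    ∀ᶠ y in 𝓝 x, Function.Surjective (A y) := by
  obtain ⟨R, hR⟩ := (A x).toLinearMap.exists_rightInverse_of_surjective
    (LinearMap.range_eq_top.2 hs)
  -- `A y ∘ R'` is an endomorphism of `F` equal to `1` at `y = x`, hence a unit for `y` near `x`.
  set R' : F →L[ℂ] E := LinearMap.toContinuousLinearMap R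
  have hR' : (A x).comp R' = 1 := by
    ext v
    exact LinearMap.congr_fun hR v
  have : CompleteSpace F := FiniteDimensional.complete ℂ F
  have hc : ContinuousAt (fun y => (A y).comp R') x := hA.clm_comp continuousAt_const
  have hu : ∀ᶠ T in 𝓝 ((A x).comp R'), IsUnit T := by
    rw [hR']
    exact Units.isOpen.mem_nhds isUnit_one
  filter_upwards [hc.eventually hu] with y hy
  obtain ⟨U, hU⟩ := hy
  intro v
  refine ⟨R' ((↑U⁻¹ : F →L[ℂ] F) v), ?_⟩
  have h1 : ((U : F →L[ℂ] F) * (↑U⁻¹ : F →L[ℂ] F)) v = v := by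
    rw [Units.mul_inv]; rfl
  rw [hU] at h1
  exact h1

end Local

/-! ### Homogeneous coordinates -/

theorem mem_cone_mk {A : Set (Proj n)} {X : Vec n} (hX : X ≠ 0) :
    X ∈ cone A ↔ Projectivization.mk ℂ X hX ∈ A :=
  ⟨fun ⟨_, h⟩ => h, fun h => ⟨hX, h⟩⟩

theorem mem_bicone_mk {A : Set (Proj n × Proj n)} {X u : Vec n} (hX : X ≠ 0) (hu : u ≠ 0) :
    (X, u) ∈ bicone A ↔ (Projectivization.mk ℂ X hX, Projectivization.mk ℂ u hu) ∈ A :=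
  ⟨fun ⟨_, _, h⟩ => h, fun h => ⟨hX, hu, h⟩⟩

theorem mk_smul {X : Vec n} (hX : X ≠ 0) {a : ℂ} (ha : a ≠ 0) :
    Projectivization.mk ℂ (a • X) (smul_ne_zero ha hX) = Projectivization.mk ℂ X hX :=
  (Projectivization.mk_eq_mk_iff' _ _ _ _ _).2 ⟨a, rfl⟩

theorem smul_mem_bicone {A : Set (Proj n × Proj n)} {X u : Vec n} {a b : ℂ} (ha : a ≠ 0)
    (hb : b ≠ 0) : (a • X, b • u) ∈ bicone A ↔ (X, u) ∈ bicone A := by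
  by_cases hX : X = 0
  · subst hX
    exact ⟨fun h => absurd (smul_zero a) h.1, fun h => absurd rfl h.1⟩
  by_cases hu : u = 0
  · subst hu
    exact ⟨fun h => absurd (smul_zero b) h.2.1, fun h => absurd rfl h.2.1⟩
  rw [mem_bicone_mk hX hu, mem_bicone_mk (smul_ne_zero ha hX) (smul_ne_zero hb hu),
    mk_smul hX ha, mk_smul hu hb]

theorem rep_mem_cone {A : Set (Proj n)} {h : Proj n} : h.rep ∈ cone A ↔ h ∈ A := by
  rw [mem_cone_mk h.rep_nonzero, h.mk_rep]

theorem rep_mem_bicone {A : Set (Proj n × Proj n)} {m h : Proj n} :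
    (m.rep, h.rep) ∈ bicone A ↔ (m, h) ∈ A := by
  rw [mem_bicone_mk m.rep_nonzero h.rep_nonzero, m.mk_rep, h.mk_rep]

theorem mem_bicone_contactElements {X u : Vec n} (hX : X ≠ 0) (hu : u ≠ 0) :
    (X, u) ∈ bicone (contactElements n) ↔ u ⬝ᵥ X = 0 := by
  rw [mem_bicone_mk hX hu, dotProduct_comm]
  exact Projectivization.orthogonal_mk hX hu

theorem mem_cone_hyperplane {X u : Vec n} (hX : X ≠ 0) (hu : u ≠ 0) :
    X ∈ cone (hyperplane (Projectivization.mk ℂ u hu)) ↔ u ⬝ᵥ X = 0 := by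
  rw [mem_cone_mk hX, dotProduct_comm]
  exact Projectivization.orthogonal_mk hX hu

theorem exists_rep_eq_smul {X : Vec n} (hX : X ≠ 0) :
    ∃ a : ℂ, a ≠ 0 ∧ (Projectivization.mk ℂ X hX).rep = a • X := by
  obtain ⟨a, ha⟩ := Projectivization.exists_smul_eq_mk_rep ℂ X hX
  exact ⟨a, a.ne_zero, ha.symm⟩

/-! ### The topology of projective space -/

theorem isOpen_iff_cone {U : Set (Proj n)} : IsOpen U ↔ IsOpen (cone U) := by
  have h1 : IsOpen U ↔ IsOpen ((fun v : {v : Vec n // v ≠ 0} =>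
    Projectivization.mk ℂ v.1 v.2) ⁻¹' U) := isOpen_coinduced
  refine h1.trans <|
    (isOpen_ne (x := (0 : Vec n))).isOpenEmbedding_subtypeVal.isOpen_iff_image_isOpen.trans ?_
  have : Subtype.val '' ((fun v : {v : Vec n // v ≠ 0} =>
      Projectivization.mk ℂ v.1 v.2) ⁻¹' U) = cone U := by
    ext X
    constructor
    · rintro ⟨v, hv, rfl⟩
      exact ⟨v.2, hv⟩
    · rintro ⟨hX, h⟩
      exact ⟨⟨X, hX⟩, h, rfl⟩
  exact Iff.of_eq (congrArg IsOpen this)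

/-- The projection to `Proj n` is open: the cone over the image of an open set is a union of its
nonzero homothets. -/
theorem mem_nhds_mk {N : Set (Proj n)} {X : Vec n} (hX : X ≠ 0) :
    N ∈ 𝓝 (Projectivization.mk ℂ X hX) ↔ cone N ∈ 𝓝 X := by
  constructor
  · intro h
    obtain ⟨U, hUN, hU, hm⟩ := mem_nhds_iff.1 h
    exact mem_of_superset ((isOpen_iff_cone.1 hU).mem_nhds ⟨hX, hm⟩)
      fun Y ⟨hY, h⟩ => ⟨hY, hUN h⟩
  · intro h
    obtain ⟨V, hVN, hV, hm⟩ := mem_nhds_iff.1 h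
    refine mem_nhds_iff.2 ⟨{m | ∃ Y, ∃ hY : Y ≠ 0, Y ∈ V ∧ m = Projectivization.mk ℂ Y hY}, ?_, ?_,
      ⟨X, hX, hm, rfl⟩⟩
    · rintro m ⟨Y, hY, hYV, rfl⟩
      exact (mem_cone_mk hY).1 (hVN hYV)
    · rw [isOpen_iff_cone, isOpen_iff_mem_nhds]
      rintro Z ⟨hZ, Y, hY, hYV, hZY⟩
      obtain ⟨a, ha⟩ := (Projectivization.mk_eq_mk_iff' _ _ _ hY hZ).1 hZY.symm
      have ha0 : a ≠ 0 := by
        rintro rfl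
        exact hY (by rw [← ha, zero_smul])
      have hc : ContinuousAt (fun Z' : Vec n => a • Z') Z := by fun_prop
      have h1 : ∀ᶠ Z' in 𝓝 Z, a • Z' ∈ V := hc.eventually (by
        simp only [ha]; exact hV.mem_nhds hYV)
      filter_upwards [h1, isOpen_ne.mem_nhds hZ] with Z' h2 h3
      exact ⟨h3, a • Z', smul_ne_zero ha0 h3, h2, (mk_smul h3 ha0).symm⟩

theorem eventually_nhds_mk {p : Proj n → Prop} {X : Vec n} (hX : X ≠ 0) :
    (∀ᶠ m in 𝓝 (Projectivization.mk ℂ X hX), p m) ↔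
      ∀ᶠ Y in 𝓝 X, ∀ hY : Y ≠ 0, p (Projectivization.mk ℂ Y hY) := by
  change {m | p m} ∈ _ ↔ _
  rw [mem_nhds_mk hX]
  constructor
  · intro h
    filter_upwards [h] with Y ⟨_, h⟩ _ using h
  · intro h
    filter_upwards [h, isOpen_ne.mem_nhds hX] with Y h h' using ⟨h', h h'⟩

/-! ### Noncritical points -/

/-- A kernel vector above each `v` allows any preimage to be corrected into a vertical one, and
conversely. The second form is visibly an open condition, by `eventually_surjective`. -/
theorem IsSubmersiveEquation.projects_onto_iff {W : Set (Proj n × Proj n)} {z : Vec n × Vec n}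
    {g : Vec n × Vec n → Fin n → ℂ} (hg : IsSubmersiveEquation (bicone W) z g) :
    (∀ v : Vec n, ∃ a : Vec n × Vec n, fderiv ℂ g z a = 0 ∧ a.1 = v) ↔
      Function.Surjective ((fderiv ℂ g z).comp (ContinuousLinearMap.inr ℂ (Vec n) (Vec n))) := by
  have hsplit : ∀ a : Vec n × Vec n, fderiv ℂ g z a =
      fderiv ℂ g z (a.1, 0) + fderiv ℂ g z (0, a.2) := fun a => by
    rw [← map_add]; simp
  constructor
  · intro h y
    obtain ⟨a, ha⟩ := hg.surjective y
    obtain ⟨b, hb, hba⟩ := h a.1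
    refine ⟨a.2 - b.2, ?_⟩
    have h1 : ((0, a.2 - b.2) : Vec n × Vec n) = a - b := by
      ext i <;> simp [hba]
    simp [h1, ha, hb]
  · intro h v
    obtain ⟨w, hw⟩ := h (-fderiv ℂ g z (v, 0))
    refine ⟨(v, w), ?_, rfl⟩
    rw [hsplit]
    simp at hw
    simp [hw]

theorem IsSubmersiveEquation.eventually {E : Type*} [NormedAddCommGroup E] [NormedSpace ℂ E]
    {A : Set E} {z : E} {c : ℕ} {g : E → Fin c → ℂ} (hg : IsSubmersiveEquation A z g) :
    ∀ᶠ y in 𝓝 z, y ∈ A → IsSubmersiveEquation A y g := by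
  filter_upwards [hg.analyticAt.eventually_analyticAt, hg.mem_iff.eventually_nhds,
    eventually_surjective hg.analyticAt.fderiv.continuousAt hg.surjective] with y h1 h2 h3 h4
  exact ⟨h4, h1, h3, h2⟩

theorem IsNoncritical.eventually {W : Set (Proj n × Proj n)} {z : Vec n × Vec n}
    (h : IsNoncritical W z) : ∀ᶠ y in 𝓝 z, y ∈ bicone W → IsNoncritical W y := by
  obtain ⟨g, hg, hp⟩ := h
  have hc : ContinuousAt (fun y => (fderiv ℂ g y).comp
      (ContinuousLinearMap.inr ℂ (Vec n) (Vec n))) z :=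
    hg.analyticAt.fderiv.continuousAt.clm_comp continuousAt_const
  filter_upwards [hg.eventually, eventually_surjective hc (hg.projects_onto_iff.1 hp)]
    with y h1 h2 h3
  exact ⟨g, h1 h3, (h1 h3).projects_onto_iff.2 h2⟩

/-- The equation is pulled back by the inverse rescaling. Since `criticalSet` refers to chosen
representatives, this is what makes it independent of the choice. -/
theorem IsNoncritical.smul {W : Set (Proj n × Proj n)} {X u : Vec n} (h : IsNoncritical W (X, u))
    {a b : ℂ} (ha : a ≠ 0) (hb : b ≠ 0) : IsNoncritical W (a • X, b • u) := by
  obtain ⟨g, hg, hp⟩ := h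
  set M : Vec n × Vec n →L[ℂ] Vec n × Vec n :=
    (a⁻¹ • ContinuousLinearMap.id ℂ (Vec n)).prodMap (b⁻¹ • ContinuousLinearMap.id ℂ (Vec n)) with hM
  have hMv : ∀ y, M y = (a⁻¹ • y.1, b⁻¹ • y.2) := fun y => rfl
  have hMz : M (a • X, b • u) = (X, u) := by
    simp [hMv, smul_smul, ha, hb]
  have hMi : ∀ y : Vec n × Vec n, M (a • y.1, b • y.2) = y := fun y => by
    simp [hMv, smul_smul, ha, hb]
  have hga : AnalyticAt ℂ g (M (a • X, b • u)) := by rw [hMz]; exact hg.analyticAt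
  have hd : fderiv ℂ (g ∘ M) (a • X, b • u) = (fderiv ℂ g (X, u)).comp M := by
    rw [fderiv_comp _ hga.differentiableAt M.differentiableAt, hMz, M.fderiv]
  refine ⟨g ∘ M, ⟨(smul_mem_bicone ha hb).2 hg.mem, hga.comp (M.analyticAt _), ?_, ?_⟩, ?_⟩
  · rw [hd]
    intro y
    obtain ⟨v, hv⟩ := hg.surjective y
    exact ⟨(a • v.1, b • v.2), by simp only [ContinuousLinearMap.comp_apply, hMi, hv]⟩
  · have h1 : ∀ᶠ y in 𝓝 (M (a • X, b • u)), y ∈ bicone W ↔ g y = 0 := by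
      rw [hMz]; exact hg.mem_iff
    filter_upwards [M.continuous.continuousAt.eventually h1] with y hy
    rw [Function.comp_apply, ← hy, hMv]
    exact (smul_mem_bicone (inv_ne_zero ha) (inv_ne_zero hb)).symm
  · intro v
    obtain ⟨w, hw, hwv⟩ := hp (a⁻¹ • v)
    refine ⟨(a • w.1, b • w.2), by rw [hd, ContinuousLinearMap.comp_apply, hMi, hw], ?_⟩
    simp [hwv, smul_smul, ha]

theorem mk_mem_regularPart {W : Set (Proj n × Proj n)} {X : Vec n} (hX : X ≠ 0) :
    Projectivization.mk ℂ X hX ∈ regularPart W ↔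
      ∀ u, (X, u) ∈ bicone W → IsNoncritical W (X, u) := by
  obtain ⟨a, ha, hrX⟩ := exists_rep_eq_smul hX
  constructor
  · intro h u hu
    obtain ⟨b, hb, hru⟩ := exists_rep_eq_smul hu.2.1
    by_contra hcon
    refine h ⟨(Projectivization.mk ℂ X hX, Projectivization.mk ℂ u hu.2.1),
      ⟨(mem_bicone_mk hX hu.2.1).1 hu, fun hnc => hcon ?_⟩, rfl⟩
    simp only [hrX, hru] at hnc
    have := hnc.smul (inv_ne_zero ha) (inv_ne_zero hb)
    simpa [smul_smul, ha, hb] using this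
  · rintro h ⟨⟨m, k⟩, ⟨hW, hc⟩, hm⟩
    simp only at hm
    subst hm
    apply hc
    simp only [hrX]
    have h1 : (X, k.rep) ∈ bicone W := by
      rw [mem_bicone_mk hX k.rep_nonzero, k.mk_rep]
      exact hW
    simpa using (h _ h1).smul ha one_ne_zero

/-! ### The regular part is open and dense -/

theorem eventually_notMem_bicone {W : Set (Proj n × Proj n)} {z : Vec n × Vec n}
    (ha : IsAnalyticAt (bicone W) z) (hz : z ∉ bicone W) : ∀ᶠ y in 𝓝 z, y ∉ bicone W := by
  obtain ⟨k, g, hg, hW⟩ := ha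
  have h0 : g z ≠ 0 := fun h => hz (hW.self_of_nhds.2 h)
  filter_upwards [hW, hg.continuousAt.eventually_ne h0] with y h1 h2 h3
  exact h2 (h1.1 h3)

/-- At each `(X, u)`, being outside `W` or noncritical persists nearby; compactness of the unit
sphere in `u` makes the neighbourhood of `X` uniform, and rescaling reaches all `u`. -/
theorem isOpen_regularPart {W : Set (Proj n × Proj n)}
    (hW : ∀ z : Vec n × Vec n, z.1 ≠ 0 → z.2 ≠ 0 → IsAnalyticAt (bicone W) z) :
    IsOpen (regularPart W) := by
  rw [isOpen_iff_cone, isOpen_iff_mem_nhds]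
  rintro X ⟨hX, hXm⟩
  rw [mk_mem_regularPart] at hXm
  have key : ∀ᶠ Y in 𝓝 X, ∀ u ∈ Metric.sphere (0 : Vec n) 1,
      (Y, u) ∈ bicone W → IsNoncritical W (Y, u) := by
    refine (isCompact_sphere (0 : Vec n) 1).eventually_forall_of_forall_eventually fun u hu => ?_
    have hu0 : u ≠ 0 := by
      rintro rfl
      simp at hu
    by_cases hmem : (X, u) ∈ bicone W
    · exact (hXm u hmem).eventually
    · exact (eventually_notMem_bicone (hW (X, u) hX hu0) hmem).mono fun y hy h => absurd h hy
  filter_upwards [key, isOpen_ne.mem_nhds hX] with Y hY hY0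
  refine ⟨hY0, (mk_mem_regularPart hY0).2 fun u hu => ?_⟩
  have hu0 : (‖u‖ : ℂ) ≠ 0 := by simpa using hu.2.1
  have h1 := hY ((‖u‖ : ℂ)⁻¹ • u) (by simp [norm_smul, hu.2.1]) (by
    simpa using (smul_mem_bicone one_ne_zero (inv_ne_zero hu0)).2 hu)
  simpa [smul_smul, hu0] using h1.smul one_ne_zero hu0

/-- The cone over the caustic is covered by countably many smooth images of open subsets of `ℂ × ℂ ^
(n - 1)`, so its Hausdorff dimension is at most `2n < 2(n + 1)`. The extra factor `ℂ` accounts for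
scalings. -/
theorem dense_regularPart {W : Set (Proj n × Proj n)} (hn : 1 ≤ n)
    (hW : HasDimLE (criticalSet W) (n - 1)) : Dense (regularPart W) := by
  obtain ⟨Ω, φ, hΩ, hcov⟩ := hW
  set ψ : ℕ → ℂ × (Fin (n - 1) → ℂ) → Vec n := fun i p => p.1 • (φ i p.2).1
  have hdim : dimH (⋃ i, ψ i '' (Set.univ ×ˢ Ω i)) < Module.finrank ℝ (Vec n) := by
    have hle : dimH (⋃ i, ψ i '' (Set.univ ×ˢ Ω i)) ≤
        Module.finrank ℝ (ℂ × (Fin (n - 1) → ℂ)) := by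
      rw [dimH_iUnion]
      refine iSup_le fun i => ?_
      rw [← Real.dimH_univ_eq_finrank]
      refine le_trans (dimH_image_le_of_locally_lipschitzOn fun p hp => ?_)
        (dimH_mono (Set.subset_univ _))
      have h1 : ContDiffAt ℂ 1 (ψ i) p := by
        have h2 : ContDiffAt ℂ 1 (φ i) p.2 := ((hΩ i).2 _ hp.2).contDiffAt
        exact contDiffAt_fst.smul (h2.fst.comp p contDiffAt_snd)
      obtain ⟨K, t, ht, hK⟩ := h1.exists_lipschitzOnWith
      exact ⟨K, t, mem_nhdsWithin_of_mem_nhds ht, hK⟩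
    refine hle.trans_lt ?_
    rw [Module.finrank_prod, Module.finrank_pi_fintype, Module.finrank_pi_fintype]
    simp only [Complex.finrank_real_complex, Finset.sum_const, Finset.card_univ, Fintype.card_fin,
      smul_eq_mul]
    norm_cast
    omega
  have hd := dense_compl_of_dimH_lt_finrank hdim
  rw [dense_iff_inter_open]
  rintro U hU ⟨m, hm⟩
  obtain ⟨Y, ⟨hY, hYU⟩, hYc⟩ := hd.inter_open_nonempty _ (isOpen_iff_cone.1 hU)
    ⟨m.rep, rep_mem_cone.2 hm⟩
  refine ⟨_, hYU, ?_⟩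
  rintro ⟨w, hw, hwY⟩
  obtain ⟨i, t, ht, h1, h2, rfl⟩ := hcov w hw
  simp only at hwY
  obtain ⟨a, ha⟩ := (Projectivization.mk_eq_mk_iff' _ _ _ hY h1).1 hwY.symm
  exact hYc (Set.mem_iUnion.2 ⟨i, (a, t), ⟨trivial, ht⟩, ha⟩)

/-! ### The equations of a complete intersection web and their differentials -/

theorem eval_mul_pow_of_isWeightedHomogeneous {σ R : Type*} [Fintype σ] [CommSemiring R]
    {w : σ → ℕ} {H : MvPolynomial σ R} {k : ℕ} (hH : MvPolynomial.IsWeightedHomogeneous w H k)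
    (t : R) (x : σ → R) :
    MvPolynomial.eval (fun i => t ^ w i * x i) H = t ^ k * MvPolynomial.eval x H := by
  rw [MvPolynomial.eval_eq', MvPolynomial.eval_eq', Finset.mul_sum]
  refine Finset.sum_congr rfl fun d hd => ?_
  have h1 := hH (MvPolynomial.mem_support_iff.1 hd)
  rw [Finsupp.weight_apply, Finsupp.sum_fintype _ _ (by simp)] at h1
  simp_rw [mul_pow, Finset.prod_mul_distrib, ← pow_mul, Finset.prod_pow_eq_pow_sum]
  rw [← h1]
  simp_rw [smul_eq_mul, mul_comm (w _)]
  ring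

theorem GlobalPDE.evalAt_smul_left (S : GlobalPDE n) (t : ℂ) (X u : Vec n) :
    evalAt S.H (t • X, u) = t ^ S.δ * evalAt S.H (X, u) := by
  rw [evalAt, evalAt, ← eval_mul_pow_of_isWeightedHomogeneous S.homogeneous_left]
  congr 2
  funext i
  rcases i with i | i <;> simp

theorem GlobalPDE.evalAt_smul_right (S : GlobalPDE n) (t : ℂ) (X u : Vec n) :
    evalAt S.H (X, t • u) = t ^ S.d * evalAt S.H (X, u) := by
  rw [evalAt, evalAt, ← eval_mul_pow_of_isWeightedHomogeneous S.homogeneous_right]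
  congr 2
  funext i
  rcases i with i | i <;> simp

theorem analyticAt_evalAt (H : MvPolynomial (Fin (n + 1) ⊕ Fin (n + 1)) ℂ) (z : Vec n × Vec n) :
    AnalyticAt ℂ (evalAt H) z := by
  have h := AnalyticAt.aeval_mvPolynomial (𝕜 := ℂ) (f := fun y : Vec n × Vec n => Sum.elim y.1 y.2)
    (z := z) (fun i => ?_) H
  · exact h
  · rcases i with i | i
    · exact ((ContinuousLinearMap.proj (R := ℂ) (φ := fun _ : Fin (n + 1) => ℂ) i).comp
        (ContinuousLinearMap.fst ℂ (Vec n) (Vec n))).analyticAt z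
    · exact ((ContinuousLinearMap.proj (R := ℂ) (φ := fun _ : Fin (n + 1) => ℂ) i).comp
        (ContinuousLinearMap.snd ℂ (Vec n) (Vec n))).analyticAt z

theorem GlobalPDE.mem_bicone_locus (S : GlobalPDE n) {X u : Vec n} (hX : X ≠ 0) (hu : u ≠ 0) :
    (X, u) ∈ bicone S.locus ↔ u ⬝ᵥ X = 0 ∧ evalAt S.H (X, u) = 0 := by
  obtain ⟨a, ha, hrX⟩ := exists_rep_eq_smul hX
  obtain ⟨b, hb, hru⟩ := exists_rep_eq_smul hu
  rw [mem_bicone_mk hX hu, ← mem_bicone_contactElements hX hu, mem_bicone_mk hX hu]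
  refine and_congr Iff.rfl ?_
  simp only [hrX, hru, S.evalAt_smul_left, S.evalAt_smul_right]
  simp [ha, hb]

theorem GlobalPDE.fderiv_evalAt_smul_left (S : GlobalPDE n) {t : ℂ} (X u a b : Vec n) :
    fderiv ℂ (evalAt S.H) (t • X, u) (t • a, b) =
      t ^ S.δ * fderiv ℂ (evalAt S.H) (X, u) (a, b) := by
  set M : Vec n × Vec n →L[ℂ] Vec n × Vec n :=
    (t • ContinuousLinearMap.id ℂ (Vec n)).prodMap (ContinuousLinearMap.id ℂ (Vec n)) with hM
  have hMv : ∀ y, M y = (t • y.1, y.2) := fun y => rfl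
  have h1 : evalAt S.H ∘ M = fun y => t ^ S.δ * evalAt S.H y := by
    funext y
    exact S.evalAt_smul_left t y.1 y.2
  have h2 := fderiv_comp (𝕜 := ℂ) (X, u) (analyticAt_evalAt S.H (M (X, u))).differentiableAt
    M.differentiableAt
  rw [h1, fderiv_const_mul (analyticAt_evalAt S.H _).differentiableAt, M.fderiv] at h2
  exact (DFunLike.congr_fun h2 (a, b)).symm

/-- The equation of the cone of the manifold of contact elements. -/
theorem hasFDerivAt_contact (z : Vec n × Vec n) :
    ∃ L : Vec n × Vec n →L[ℂ] ℂ, HasFDerivAt (fun y : Vec n × Vec n => y.2 ⬝ᵥ y.1) L z ∧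
      ∀ a, L a = z.2 ⬝ᵥ a.1 + a.2 ⬝ᵥ z.1 := by
  have h1 : ∀ i, HasFDerivAt (fun y : Vec n × Vec n => y.2 i * y.1 i) _ z := fun i =>
    ((((ContinuousLinearMap.proj (R := ℂ) (φ := fun _ : Fin (n + 1) => ℂ) i).comp
        (ContinuousLinearMap.snd ℂ (Vec n) (Vec n)))).hasFDerivAt (x := z)).mul
    (((ContinuousLinearMap.proj (R := ℂ) (φ := fun _ : Fin (n + 1) => ℂ) i).comp
        (ContinuousLinearMap.fst ℂ (Vec n) (Vec n)))).hasFDerivAt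
  refine ⟨_, HasFDerivAt.fun_sum fun i _ => h1 i, fun a => ?_⟩
  simp [dotProduct, Finset.sum_add_distrib, mul_comm]

theorem analyticAt_contact (z : Vec n × Vec n) :
    AnalyticAt ℂ (fun y : Vec n × Vec n => y.2 ⬝ᵥ y.1) z := by
  refine Finset.analyticAt_fun_sum _ fun i _ => ?_
  exact (((ContinuousLinearMap.proj (R := ℂ) (φ := fun _ : Fin (n + 1) => ℂ) i).comp
        (ContinuousLinearMap.snd ℂ (Vec n) (Vec n))).analyticAt z).mul
    (((ContinuousLinearMap.proj (R := ℂ) (φ := fun _ : Fin (n + 1) => ℂ) i).comp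
        (ContinuousLinearMap.fst ℂ (Vec n) (Vec n))).analyticAt z)

theorem exists_dotProduct_eq_one {u : Vec n} (hu : u ≠ 0) : ∃ e : Vec n, u ⬝ᵥ e = 1 := by
  obtain ⟨i, hi⟩ := Function.ne_iff.1 hu
  exact ⟨Pi.single i (u i)⁻¹, by simpa using mul_inv_cancel₀ hi⟩

theorem IsCIWeb.mem_bicone {W : Set (Proj n × Proj n)} {S : Fin (n - 1) → GlobalPDE n}
    (hW : IsCIWeb W S) {X u : Vec n} (hX : X ≠ 0) (hu : u ≠ 0) :
    (X, u) ∈ bicone W ↔ u ⬝ᵥ X = 0 ∧ ∀ α, evalAt (S α).H (X, u) = 0 := by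
  rw [mem_bicone_mk hX hu]
  conv_lhs => rw [hW.eq_inter]
  have h1 : ∀ α, (Projectivization.mk ℂ X hX, Projectivization.mk ℂ u hu) ∈ (S α).locus ↔
      u ⬝ᵥ X = 0 ∧ evalAt (S α).H (X, u) = 0 := fun α => by
    rw [← (S α).mem_bicone_locus hX hu, mem_bicone_mk hX hu]
  have h2 := mem_bicone_contactElements hX hu
  rw [mem_bicone_mk hX hu] at h2
  rw [Set.mem_ofPred_eq, h2]
  simp only [h1]
  exact ⟨fun h => ⟨h.1, fun α => (h.2 α).2⟩, fun h => ⟨h.1, fun α => ⟨h.1, h.2 α⟩⟩⟩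

/-- On the cone of contact elements, the differential of a germ vanishing on a complete
intersection web is a linear combination of the differentials of the equations. -/
theorem IsCIWeb.exists_fderiv_eq_sum {W : Set (Proj n × Proj n)} {S : Fin (n - 1) → GlobalPDE n}
    (hW : IsCIWeb W S) {z : Vec n × Vec n} (hz : z ∈ bicone W) {f : Vec n × Vec n → ℂ}
    (hf : GermVanishesOn (bicone W) z f) :
    ∃ b : Fin (n - 1) → ℂ, ∀ a : Vec n × Vec n, z.2 ⬝ᵥ a.1 + a.2 ⬝ᵥ z.1 = 0 →
      fderiv ℂ f z a = ∑ α, b α * fderiv ℂ (evalAt (S α).H) z a := by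
  have hX : z.1 ≠ 0 := hz.1
  have hu : z.2 ≠ 0 := hz.2.1
  obtain ⟨F, hF, hfF⟩ := hW.ideal z hz f hf
  obtain ⟨hq, hH⟩ := (hW.mem_bicone hX hu).1 hz
  have hred : ∀ α, ∃ b : Vec n × Vec n → ℂ, AnalyticAt ℂ b z ∧
      ∀ᶠ y in 𝓝 z, y ∈ bicone (contactElements n) → F α y = b y * evalAt (S α).H y := fun α =>
    (S α).reduced z (((S α).mem_bicone_locus hX hu).2 ⟨hq, hH α⟩) (F α) (hF α)
  choose b hb hFb using hred
  refine ⟨fun α => b α z, fun a ha => ?_⟩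
  obtain ⟨L, hL, hLa⟩ := hasFDerivAt_contact z
  have hterm : ∀ α, HasFDerivAt (fun y => b α y * evalAt (S α).H y)
      (b α z • fderiv ℂ (evalAt (S α).H) z + evalAt (S α).H z • fderiv ℂ (b α) z) z := fun α =>
    (hb α).differentiableAt.hasFDerivAt.mul (analyticAt_evalAt _ z).differentiableAt.hasFDerivAt
  have hd : HasFDerivAt (fun y => f y - ∑ α, b α y * evalAt (S α).H y)
      (fderiv ℂ f z - ∑ α, (b α z • fderiv ℂ (evalAt (S α).H) z +
        evalAt (S α).H z • fderiv ℂ (b α) z)) z :=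
    hf.1.differentiableAt.hasFDerivAt.sub (HasFDerivAt.fun_sum fun α _ => hterm α)
  have hne : ∀ᶠ y in 𝓝 z, y.1 ≠ 0 ∧ y.2 ≠ 0 :=
    (continuousAt_fst.eventually_ne hX).and (continuousAt_snd.eventually_ne hu)
  -- The relation between germs holds only on the contact cone, a smooth hypersurface, so
  -- differentials are compared on its tangent space. The terms in the derivatives of `b α` drop out
  -- because the equations vanish at `z`.
  have hvan : ∀ᶠ y in 𝓝 z, y.2 ⬝ᵥ y.1 = 0 → f y - ∑ α, b α y * evalAt (S α).H y = 0 := by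
    filter_upwards [hfF, eventually_all.2 hFb, hne] with y h1 h2 h3 h4
    have hy : y ∈ bicone (contactElements n) := (mem_bicone_contactElements h3.1 h3.2).2 h4
    rw [h1 hy, sub_eq_zero]
    exact Finset.sum_congr rfl fun α _ => h2 α hy
  have hs : Function.Surjective (fderiv ℂ (fun y : Vec n × Vec n => y.2 ⬝ᵥ y.1) z) := by
    rw [hL.fderiv]
    intro c
    obtain ⟨e, he⟩ := exists_dotProduct_eq_one hu
    exact ⟨(c • e, 0), by simp [hLa, he]⟩
  have h0 := fderiv_eq_zero_of_vanishing (analyticAt_contact z) hs hq hd.differentiableAt hvan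
    (v := a) (by rw [hL.fderiv, hLa, ha])
  rw [hd.fderiv] at h0
  simpa [hH, sub_eq_zero] using h0

/-! ### Tangent hyperplanes -/

theorem fderiv_eq_partialDerivs (f : Vec n → ℂ) (X v : Vec n) :
    fderiv ℂ f X v = partialDerivs f X ⬝ᵥ v := by
  conv_lhs => rw [← Finset.univ_sum_single v, map_sum]
  refine Finset.sum_congr rfl fun i _ => ?_
  have : (Pi.single i (v i) : Vec n) = v i • Pi.single i (1 : ℂ) := by
    ext j
    by_cases h : j = i
    · subst h; simp
    · simp [h]
  rw [this, map_smul, smul_eq_mul, mul_comm]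
  rfl

theorem surjective_of_clm_ne_zero {E : Type*} [NormedAddCommGroup E] [NormedSpace ℂ E]
    {L : E →L[ℂ] ℂ} (hL : L ≠ 0) : Function.Surjective L :=
  LinearMap.surjective (f := L.toLinearMap) fun h => hL (ContinuousLinearMap.coe_injective h)

/-- The linear form of coefficients `u`. -/
noncomputable def linearForm (u : Vec n) : Vec n →L[ℂ] ℂ :=
  ∑ i, u i • ContinuousLinearMap.proj (R := ℂ) (φ := fun _ : Fin (n + 1) => ℂ) i

theorem linearForm_apply (u v : Vec n) : linearForm u v = u ⬝ᵥ v := by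
  simp [linearForm, dotProduct]

theorem partialDerivs_dotProduct (u Y : Vec n) : partialDerivs (fun Y => u ⬝ᵥ Y) Y = u := by
  have : (fun Y => u ⬝ᵥ Y) = linearForm u := funext fun Y => (linearForm_apply u Y).symm
  ext i
  rw [partialDerivs, this, ContinuousLinearMap.fderiv, linearForm_apply]
  simp

/-- If a smooth hypersurface `f = 0` is contained in the hyperplane `u` near `X`, then `u` is its
tangent hyperplane. -/
theorem eq_smul_partialDerivs {f : Vec n → ℂ} {X u : Vec n} (hf : AnalyticAt ℂ f X)
    (hf0 : fderiv ℂ f X ≠ 0) (hX : f X = 0) (hfu : ∀ᶠ Y in 𝓝 X, f Y = 0 → u ⬝ᵥ Y = 0) :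
    ∃ c : ℂ, u = c • partialDerivs f X := by
  have hs := surjective_of_clm_ne_zero hf0
  obtain ⟨e, he⟩ := hs 1
  -- Since `e` has derivative `1`, subtracting `∂f/∂X_i` times `e` from the `i`-th basis vector
  -- gives a tangent vector, which `u` must annihilate.
  refine ⟨u ⬝ᵥ e, ?_⟩
  ext i
  have h1 := fderiv_eq_zero_of_vanishing hf hs hX (f := linearForm u)
    (linearForm u).differentiableAt (by simpa only [linearForm_apply] using hfu)
    (v := Pi.single i 1 - fderiv ℂ f X (Pi.single i 1) • e) (by simp [he])
  rw [ContinuousLinearMap.fderiv, map_sub, map_smul, linearForm_apply, linearForm_apply] at h1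
  simp only [dotProduct_single_one, smul_eq_mul, sub_eq_zero] at h1
  simp [h1, partialDerivs, mul_comm]

/-- The contact elements of a hyperplane which is a leaf belong to the web. -/
theorem IsLocallyLeaf.mem_bicone {W : Set (Proj n × Proj n)} {X u : Vec n} (hX : X ≠ 0)
    (hu : u ≠ 0) (hL : IsLocallyLeaf W (hyperplane (Projectivization.mk ℂ u hu)))
    (hXr : Projectivization.mk ℂ X hX ∈ regularPart W) (hXu : u ⬝ᵥ X = 0) :
    (X, u) ∈ bicone W := by
  have hXm := (mem_cone_hyperplane hX hu).2 hXu
  obtain ⟨f, hf, hf0, hfL, hfW⟩ := hL X ⟨hX, (mem_cone_mk hX).1 hXm, hXr⟩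
  have hfX : f X = 0 := hfL.self_of_nhds.1 hXm
  obtain ⟨c, hc⟩ := eq_smul_partialDerivs (u := u) hf hf0 hfX (by
    filter_upwards [hfL, isOpen_ne.mem_nhds hX] with Y h1 h2 h3
    exact (mem_cone_hyperplane h2 hu).1 (h1.2 h3))
  have hc0 : c ≠ 0 := by
    rintro rfl
    exact hu (by rw [hc, zero_smul])
  have h1 := (smul_mem_bicone one_ne_zero hc0).2 (hfW.self_of_nhds hfX)
  rwa [one_smul, ← hc] at h1

/-! ### The curve of an algebraic web -/

theorem mk_mem_zeroLocus {s : Set (MvPolynomial (Fin (n + 1)) ℂ)}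
    (hs : ∀ p ∈ s, ∃ k, p.IsHomogeneous k) {X : Vec n} (hX : X ≠ 0) :
    Projectivization.mk ℂ X hX ∈ {h : Proj n | ∀ p ∈ s, MvPolynomial.eval h.rep p = 0} ↔
      ∀ p ∈ s, MvPolynomial.eval X p = 0 := by
  obtain ⟨a, ha, hr⟩ := exists_rep_eq_smul hX
  rw [Set.mem_ofPred_eq, hr]
  refine forall₂_congr fun p hp => ?_
  obtain ⟨k, hk⟩ := hs p hp
  have h1 := eval_mul_pow_of_isWeightedHomogeneous hk a X
  have h2 : (fun i => a ^ (1 : Fin (n + 1) → ℕ) i * X i) = a • X := by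
    ext i; simp
  rw [h2] at h1
  rw [h1]
  simp [ha]

theorem IsAlgebraicCurve.isClosed {C : Set (Proj n)} {d : ℕ} (hC : IsAlgebraicCurve C d) :
    IsClosed C := by
  obtain ⟨s, hs, rfl⟩ := hC.algebraic
  rw [← isOpen_compl_iff, isOpen_iff_cone, isOpen_iff_mem_nhds]
  rintro X ⟨hX, hXC⟩
  rw [Set.mem_compl_iff, mk_mem_zeroLocus hs] at hXC
  push Not at hXC
  obtain ⟨p, hp, hpX⟩ := hXC
  have hc : ContinuousAt (fun Y : Vec n => MvPolynomial.eval Y p) X :=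
    (MvPolynomial.continuous_eval p).continuousAt
  filter_upwards [hc.eventually_ne hpX, isOpen_ne.mem_nhds hX] with Y h1 h2
  refine ⟨h2, fun h => h1 ?_⟩
  exact (mk_mem_zeroLocus hs h2).1 h p hp

/-- In dimension `0` a contact element would satisfy `u_0 X_0 = 0` with both factors nonzero, so `W`
could not project onto the point. -/
theorem one_le_of_isWeb {W : Set (Proj n × Proj n)} {d : ℕ} (hW : IsWeb W d) : 1 ≤ n := by
  by_contra hn
  obtain rfl : n = 0 := by omega
  have hm : Projectivization.mk ℂ (1 : Vec 0) one_ne_zero ∈ Prod.fst '' W := by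
    rw [hW.surjective]; trivial
  obtain ⟨⟨m, h⟩, hw, -⟩ := hm
  have h1 : (m.rep, h.rep) ∈ bicone (contactElements 0) := rep_mem_bicone.2 (hW.subset hw)
  rw [mem_bicone_contactElements m.rep_nonzero h.rep_nonzero] at h1
  have h2 : ∀ X : Vec 0, X ≠ 0 → X 0 ≠ 0 := fun X hX h0 => hX (by
    ext i
    rw [show i = 0 from Fin.ext (by omega), h0]
    rfl)
  simp [dotProduct, h2 _ m.rep_nonzero, h2 _ h.rep_nonzero] at h1

section AlgebraicWeb

variable {W : Set (Proj n × Proj n)} {d : ℕ} {C : Set (Proj n)}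

/-- The regular part, intersected with any dense open set, is dense. -/
theorem IsWeb.dense_inter (hW : IsWeb W d) {O : Set (Proj n)} (hO : IsOpen O) (hOd : Dense O) :
    Dense (regularPart W ∩ O) :=
  (dense_regularPart (one_le_of_isWeb hW) hW.critical_dim).inter_of_isOpen_right hOd hO

/-- The hyperplanes of `C` through `m` are leaves, so they lie in the fiber; both sets have `d`
elements. -/
theorem IsWeb.fiber_eq (hW : IsWeb W d) (hL : ∀ h ∈ C, IsLocallyLeaf W (hyperplane h))
    {m : Proj n} (hm : m ∈ regularPart W) (hd : {h | h ∈ C ∧ m ∈ hyperplane h}.encard = d) :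
    {h | h ∈ C ∧ m ∈ hyperplane h} = fiber W m := by
  have hfin : (fiber W m).Finite := Set.finite_of_encard_eq_coe (hW.sheets m hm)
  refine hfin.eq_of_subset_of_encard_le' ?_ (by rw [hd, hW.sheets m hm])
  rintro h ⟨hC, hmh⟩
  have h1 : (m.rep, h.rep) ∈ bicone W := by
    refine IsLocallyLeaf.mem_bicone m.rep_nonzero h.rep_nonzero ?_ ?_ ?_
    · rw [h.mk_rep]; exact hL h hC
    · rw [m.mk_rep]; exact hm
    · rw [← mem_cone_hyperplane m.rep_nonzero h.rep_nonzero, h.mk_rep]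
      exact rep_mem_cone.2 hmh
  exact rep_mem_bicone.1 h1

/-- Were `h` outside the closed set `C`, a neighbourhood of `h` would miss the fibers over the
generic points near `m`, which consist of elements of `C`. The multiplicity of `h` would be `0`,
although `h` is in the fiber. -/
theorem IsWeb.snd_mem_curve (hW : IsWeb W d) (hC : IsAlgebraicCurve C d)
    (hL : ∀ h ∈ C, IsLocallyLeaf W (hyperplane h)) {m h : Proj n} (hw : (m, h) ∈ W) : h ∈ C := by
  obtain ⟨O, hO, hOd, hdeg⟩ := hC.degree
  obtain ⟨-, μ, hμ, hμN, -⟩ := hW.fiber_degree m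
  by_contra hh
  obtain ⟨N', -, hN', hev⟩ := hμN h Cᶜ (hC.isClosed.isOpen_compl.mem_nhds hh)
  obtain ⟨m', h1, h2⟩ := (mem_closure_iff_frequently.1 (hW.dense_inter hO hOd m)).and_eventually
    hev |>.exists
  have h3 := h2 h1.1
  have h4 : fiber W m' ∩ N' = ∅ := by
    rw [← hW.fiber_eq hL h1.1 (hdeg m' h1.2)]
    ext k
    simp only [Set.mem_inter_iff, Set.mem_empty_iff_false, iff_false]
    rintro ⟨⟨hk, -⟩, hk'⟩
    exact hN' hk' hk
  rw [h4, Set.encard_empty] at h3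
  have h5 := (hμ h).2 hw
  have h6 : μ h = 0 := by exact_mod_cast h3.symm
  omega

end AlgebraicWeb

/-- A polynomial in `X` which vanishes near a point of the hyperplane `u` vanishes on it. -/
theorem evalAt_eq_zero_of_eventually {H : MvPolynomial (Fin (n + 1) ⊕ Fin (n + 1)) ℂ}
    {X u : Vec n} (hXu : u ⬝ᵥ X = 0)
    (h : ∀ᶠ Y in 𝓝 X, u ⬝ᵥ Y = 0 → evalAt H (Y, u) = 0) {Y : Vec n} (hY : u ⬝ᵥ Y = 0) :
    evalAt H (Y, u) = 0 := by
  -- Identity theorem on the complex line from `X` to `Y`, which stays in the hyperplane.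
  have ha : AnalyticOnNhd ℂ (fun t : ℂ => evalAt H (X + t • (Y - X), u)) Set.univ := fun t _ => by
    have h1 : AnalyticAt ℂ (fun t : ℂ => ((X + t • (Y - X), u) : Vec n × Vec n)) t :=
      (analyticAt_const.add (analyticAt_id.smul analyticAt_const)).prod analyticAt_const
    exact (analyticAt_evalAt H _).comp h1
  have hc : Tendsto (fun t : ℂ => X + t • (Y - X)) (𝓝 0) (𝓝 X) := by
    have : Continuous (fun t : ℂ => X + t • (Y - X)) := by fun_prop
    simpa using this.tendsto 0
  have hz : (fun t : ℂ => evalAt H (X + t • (Y - X), u)) =ᶠ[𝓝 0] fun _ => 0 := by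
    filter_upwards [hc.eventually h] with t ht
    exact ht (by simp [hXu, hY])
  have := congrFun (ha.eq_of_eventuallyEq analyticOnNhd_const hz) 1
  simpa using this

/-- A generic hyperplane belonging to the curve of an algebraic web is given by a
regular point of this curve, and all its contact elements belong to the web. -/
theorem IsCIWeb.exists_regular_hyperplane {W : Set (Proj n × Proj n)}
    {S : Fin (n - 1) → GlobalPDE n} (hW : IsCIWeb W S) {d : ℕ} (hWd : IsWeb W d) {C : Set (Proj n)}
    (hC : IsAlgebraicCurve C d) (hL : ∀ h ∈ C, IsLocallyLeaf W (hyperplane h)) :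
    ∃ u, u ≠ 0 ∧ IsRegularPoint (cone C) (n - 1) u ∧
      ∀ Y, Y ≠ 0 → u ⬝ᵥ Y = 0 → (Y, u) ∈ bicone W := by
  obtain ⟨O, hO, hOd, hdeg⟩ := hC.degree
  have : Nonempty (Proj n) := ⟨Projectivization.mk ℂ (1 : Vec n) one_ne_zero⟩
  obtain ⟨m, hm, hmO⟩ := (hWd.dense_inter hO hOd).nonempty
  obtain ⟨h, hhC, hmh⟩ : {h | h ∈ C ∧ m ∈ hyperplane h}.Nonempty := by
    rw [← Set.encard_pos, hdeg m hmO]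
    exact_mod_cast hWd.one_le
  set X := m.rep
  set v := h.rep
  have hX : X ≠ 0 := m.rep_nonzero
  have hv : v ≠ 0 := h.rep_nonzero
  have hvX : v ⬝ᵥ X = 0 := by
    rw [← mem_cone_hyperplane hX hv, h.mk_rep]
    exact rep_mem_cone.2 hmh
  have hreg := isOpen_iff_cone.1 (isOpen_regularPart hWd.analytic)
  obtain ⟨e, he⟩ := exists_dotProduct_eq_one hv
  have hce : Continuous fun u : Vec n => u ⬝ᵥ e := by
    simp only [dotProduct]; fun_prop
  have hcX : Continuous fun u : Vec n => u ⬝ᵥ X := by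
    simp only [dotProduct]; fun_prop
  -- For `u` near `v`, moving `X` along `e` gives a point of the hyperplane `u` that is still in the
  -- regular part. There the hyperplane is a leaf, and the vanishing of the equations then spreads
  -- over all of it.
  have hcont : ContinuousAt (fun u : Vec n => X - ((u ⬝ᵥ X) / (u ⬝ᵥ e)) • e) v :=
    continuousAt_const.sub ((hcX.continuousAt.div hce.continuousAt (by simp [he])).smul
      continuousAt_const)
  have hev : ∀ᶠ u in 𝓝 v, X - ((u ⬝ᵥ X) / (u ⬝ᵥ e)) • e ∈ cone (regularPart W) := by
    refine hcont.eventually (hreg.mem_nhds ?_)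
    simpa [hvX] using rep_mem_cone.2 hm
  have hev2 : ∀ᶠ u in 𝓝 v, u ⬝ᵥ e ≠ 0 := hce.continuousAt.eventually_ne (by simp [he])
  obtain ⟨u, hu, hu1, hu2⟩ := (mem_closure_iff_frequently.1 (hC.pureDim
    (rep_mem_cone.2 hhC))).and_eventually (hev.and hev2) |>.exists
  obtain ⟨F, hF⟩ := hu
  obtain ⟨hu0, huC⟩ := hF.mem
  refine ⟨u, hu0, ⟨F, hF⟩, fun Y hY huY => ?_⟩
  rw [hW.mem_bicone hY hu0]
  refine ⟨huY, fun α => evalAt_eq_zero_of_eventually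
    (X := X - ((u ⬝ᵥ X) / (u ⬝ᵥ e)) • e) ?_ ?_ huY⟩
  · simp [hu2]
  · filter_upwards [hreg.mem_nhds hu1] with Z hZ huZ
    have h1 := (hL _ huC).mem_bicone hZ.1 hu0 hZ.2 huZ
    exact ((hW.mem_bicone hZ.1 hu0).1 h1).2 α

/-! ### Algebraic webs have multi-degree zero -/

/-- A homogeneous holomorphic function without zeros on a projective line has degree `0`. -/
theorem degree_eq_zero_of_ne_zero {V : Type*} [AddCommGroup V] [Module ℂ V] {D : V → ℂ} {N : ℕ}
    (hD : ∀ (t : ℂ) v, D (t • v) = t ^ N * D v) {v w : V}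
    (h1 : Differentiable ℂ fun t : ℂ => D (v + t • w))
    (h2 : ContinuousAt (fun t : ℂ => D (t • v + w)) 0)
    (hne : ∀ t : ℂ, D (v + t • w) ≠ 0) (hw : D w ≠ 0) : N = 0 := by
  by_contra hN
  have hinv : Differentiable ℂ fun t : ℂ => (D (v + t • w))⁻¹ := h1.inv hne
  -- With `s = t⁻¹`, the inverse equals `s ^ N / D (s • v + w)`, which tends to `0` when `N > 0`;
  -- Liouville's theorem then contradicts its nonvanishing.
  have hlim : Tendsto (fun t : ℂ => (D (v + t • w))⁻¹) (cocompact ℂ) (𝓝 0) := by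
    have h3 : Tendsto (fun t : ℂ => t⁻¹) (cocompact ℂ) (𝓝 0) := by
      rw [← Metric.cobounded_eq_cocompact]
      exact tendsto_inv₀_cobounded
    have h4 : Tendsto (fun s : ℂ => s ^ N * (D (s • v + w))⁻¹) (𝓝 0) (𝓝 0) := by
      have h5 : ContinuousAt (fun s : ℂ => s ^ N * (D (s • v + w))⁻¹) 0 :=
        (continuousAt_id.pow N).mul (h2.inv₀ (by simpa using hw))
      simpa [ContinuousAt, hN] using h5
    refine (h4.comp h3).congr' ?_
    have h0 : ∀ᶠ t : ℂ in cocompact ℂ, t ≠ 0 := by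
      have := (isCompact_singleton (x := (0 : ℂ))).compl_mem_cocompact
      filter_upwards [this] with t ht using ht
    filter_upwards [h0] with t ht
    have h6 : v + t • w = t • (t⁻¹ • v + w) := by
      rw [smul_add, smul_smul, mul_inv_cancel₀ ht, one_smul]
    rw [h6, hD, mul_inv, Function.comp_apply, inv_pow]
  exact inv_ne_zero (hne 0) (hinv.apply_eq_of_tendsto_cocompact 0 hlim)

theorem exists_linearIndependent_orthogonal (hn : 2 ≤ n) (u : Vec n) :
    ∃ v w : Vec n, u ⬝ᵥ v = 0 ∧ u ⬝ᵥ w = 0 ∧ w ≠ 0 ∧ ∀ t : ℂ, v + t • w ≠ 0 := by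
  set K := LinearMap.ker (linearForm u).toLinearMap
  have h1 : 1 < Module.finrank ℂ K := by
    have h2 : _ + Module.finrank ℂ K = _ :=
      LinearMap.finrank_range_add_finrank_ker (linearForm u).toLinearMap
    have h3 := Submodule.finrank_le (LinearMap.range (linearForm u).toLinearMap)
    rw [Module.finrank_self] at h3
    rw [Module.finrank_fin_fun] at h2
    omega
  have : Nontrivial K := Module.nontrivial_of_finrank_pos (R := ℂ) (by omega)
  obtain ⟨w, hw⟩ := exists_ne (0 : K)
  obtain ⟨v, hv⟩ := exists_linearIndependent_pair_of_one_lt_finrank h1 hw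
  refine ⟨v, w, ?_, ?_, by simpa using hw, fun t ht => ?_⟩
  · rw [← linearForm_apply]; exact v.2
  · rw [← linearForm_apply]; exact w.2
  · have h5 := (LinearIndependent.pair_iff.1 hv) t 1 (by
      ext1; simpa [add_comm] using ht)
    exact one_ne_zero h5.2

/-- The multi-degree of an algebraic complete intersection web is zero. -/
theorem IsCIWeb.multidegree_eq_zero {W : Set (Proj n × Proj n)}
    {S : Fin (n - 1) → GlobalPDE n} (hW : IsCIWeb W S) {d : ℕ} (hA : IsAlgebraicWeb W d) :
    multidegree S = 0 := by
  obtain ⟨hWd, C, hC, -, hL⟩ := hA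
  rcases Nat.lt_or_ge n 2 with hn | hn
  · have : IsEmpty (Fin (n - 1)) := by
      rw [Nat.sub_eq_zero_of_le (by omega)]; infer_instance
    exact Subsingleton.elim _ _
  obtain ⟨u, hu, ⟨F, hF⟩, huW⟩ := hW.exists_regular_hyperplane hWd hC hL
  obtain ⟨e, he⟩ := exists_dotProduct_eq_one hu
  choose r hr using fun k => hF.surjective (Pi.single k 1)
  -- The `r k` are dual to the differentials of the local equations `F` of `C`. The component `-(r k
  -- ⬝ᵥ X) • e` makes each direction tangent to the contact cone, and it is linear in `X`, so row
  -- `α` is homogeneous of degree `δ_α`.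
  set M : Vec n → Matrix (Fin (n - 1)) (Fin (n - 1)) ℂ := fun X => Matrix.of fun α k =>
    fderiv ℂ (evalAt (S α).H) (X, u) (-(r k ⬝ᵥ X) • e, r k) with hM
  have hdet : ∀ X, X ≠ 0 → u ⬝ᵥ X = 0 → (M X).det ≠ 0 := by
    intro X hX huX
    have hz : (X, u) ∈ bicone W := huW X hX huX
    have hFa : ∀ j, AnalyticAt ℂ (fun y => F y j) u := fun j =>
      ((ContinuousLinearMap.proj (R := ℂ) (φ := fun _ : Fin (n - 1) => ℂ) j).analyticAt _).comp
        hF.analyticAt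
    have hFd : ∀ j (y : Vec n), fderiv ℂ (fun y => F y j) u y = fderiv ℂ F u y j := fun j y => by
      rw [fderiv_apply hF.analyticAt.differentiableAt]; rfl
    have hgerm : ∀ j, GermVanishesOn (bicone W) (X, u) (fun y => F y.2 j) := fun j => by
      refine ⟨(hFa j).comp_of_eq analyticAt_snd rfl, ?_⟩
      have h1 : ∀ᶠ y : Vec n × Vec n in 𝓝 (X, u), y.2 ∈ cone C ↔ F y.2 = 0 :=
        (continuous_snd.tendsto ((X, u) : Vec n × Vec n)).eventually hF.mem_iff
      filter_upwards [h1] with y hy hyW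
      rw [hy.1 ⟨hyW.2.1, hWd.snd_mem_curve hC hL hyW.2.2⟩]
      rfl
    choose b hb using fun j => hW.exists_fderiv_eq_sum hz (hgerm j)
    -- The germs `F y.2 j` vanish on `W`; evaluating their differentials on the chosen directions
    -- gives the identity matrix.
    have hmul : Matrix.of b * M X = 1 := by
      ext j k
      have h1 := hb j (-(r k ⬝ᵥ X) • e, r k) (by simp [he])
      have h2 : fderiv ℂ (fun y : Vec n × Vec n => F y.2 j) (X, u) =
          (fderiv ℂ (fun y => F y j) u).comp (ContinuousLinearMap.snd ℂ (Vec n) (Vec n)) :=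
        (HasFDerivAt.comp (g := fun y => F y j) (f := Prod.snd) ((X, u) : Vec n × Vec n)
          (hFa j).differentiableAt.hasFDerivAt hasFDerivAt_snd).fderiv
      rw [h2] at h1
      simp only [ContinuousLinearMap.comp_apply, ContinuousLinearMap.coe_snd', hFd, hr] at h1
      rw [Matrix.mul_apply, Matrix.one_apply]
      simp only [hM, Matrix.of_apply]
      rw [← h1, Pi.single_apply]
    intro h0
    have h3 := congrArg Matrix.det hmul
    rw [Matrix.det_mul, h0, mul_zero, Matrix.det_one] at h3
    exact zero_ne_one h3
  have hhom : ∀ (t : ℂ) X, (M (t • X)).det = t ^ (∑ α, (S α).δ) * (M X).det := by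
    intro t X
    rw [← Finset.prod_pow_eq_pow_sum, ← Matrix.det_mul_column]
    congr 1
    ext α k
    simp only [hM, Matrix.of_apply]
    rw [← (S α).fderiv_evalAt_smul_left]
    congr 2
    rw [dotProduct_smul, smul_smul, smul_eq_mul, mul_neg]
  have hdiff : Differentiable ℂ fun X => (M X).det := by
    simp only [Matrix.det_apply]
    refine Differentiable.fun_sum fun σ _ => Differentiable.const_smul ?_ _
    have hent : ∀ α k, Differentiable ℂ fun X => M X α k := by
      intro α k X
      have h1 : DifferentiableAt ℂ (fun X : Vec n => fderiv ℂ (evalAt (S α).H) (X, u)) X :=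
        ((analyticAt_evalAt (S α).H (X, u)).fderiv.differentiableAt).comp
          (f := fun X : Vec n => (X, u)) X (by fun_prop)
      have h2 : DifferentiableAt ℂ
          (fun X : Vec n => ((-(r k ⬝ᵥ X) • e, r k) : Vec n × Vec n)) X := by
        simp only [dotProduct]
        fun_prop
      exact h1.clm_apply h2
    exact fun X => (HasFDerivAt.finsetProd (g := fun i X => M X (σ i) i) fun i _ =>
      (hent (σ i) i X).hasFDerivAt).differentiableAt
  obtain ⟨v, w, hv, hw, hw0, hvw⟩ := exists_linearIndependent_orthogonal hn u
  have hsum := degree_eq_zero_of_ne_zero (D := fun X => (M X).det) hhom (v := v) (w := w)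
    (hdiff.comp (by fun_prop : Differentiable ℂ fun t : ℂ => v + t • w))
    ((hdiff.continuous.comp (by fun_prop : Continuous fun t : ℂ => t • v + w)).continuousAt)
    (fun t => hdet _ (hvw t) (by simp [hv, hw])) (hdet w hw0 hw)
  funext α
  exact Finset.sum_eq_zero_iff.1 hsum α (Finset.mem_univ α)

/-! ### Leaves of a web swept out by fixed hyperplanes -/

theorem IsSubmersiveEquation.fderiv_eq_zero_of_curve {E : Type*} [NormedAddCommGroup E]
    [NormedSpace ℂ E] {A : Set E} {z : E} {c : ℕ} {g : E → Fin c → ℂ}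
    (hg : IsSubmersiveEquation A z g) {γ : ℂ → E} {t : ℂ} {v : E} (hγ : HasDerivAt γ v t)
    (ht : γ t = z) (hA : ∀ᶠ s in 𝓝 t, γ s ∈ A) : fderiv ℂ g z v = 0 := by
  subst ht
  have h1 : HasDerivAt (fun s => g (γ s)) (fderiv ℂ g (γ t) v) t :=
    HasFDerivAt.comp_hasDerivAt (f := γ) t hg.analyticAt.differentiableAt.hasFDerivAt hγ
  have h2 : (fun s => g (γ s)) =ᶠ[𝓝 t] fun _ => 0 := by
    filter_upwards [hA, hγ.continuousAt.eventually hg.mem_iff] with s h3 h4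
    exact h4.1 h3
  exact h1.unique ((hasDerivAt_const t (0 : Fin c → ℂ)).congr_of_eventuallyEq h2)

/-- At a noncritical point, the vertical tangent vectors are the scalings of `u`. -/
theorem IsNoncritical.eq_smul_of_curve {W : Set (Proj n × Proj n)} {X u p q : Vec n}
    (h : IsNoncritical W (X, u))
    (hW : ∀ Y, Y ≠ 0 → u ⬝ᵥ Y = 0 → (Y, u) ∈ bicone W) (hXu : u ⬝ᵥ X = 0) (hp : u ⬝ᵥ p = 0)
    {γ ν : ℂ → Vec n} {t : ℂ} (hγ : HasDerivAt γ p t) (hν : HasDerivAt ν q t) (hγt : γ t = X)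
    (hνt : ν t = u) (hmem : ∀ᶠ s in 𝓝 t, (γ s, ν s) ∈ bicone W) : ∃ c : ℂ, q = c • u := by
  obtain ⟨g, hg, hproj⟩ := h
  obtain ⟨hX, hu, -⟩ := hg.mem
  simp only at hX hu
  have h1 : fderiv ℂ g (X, u) (p, q) = 0 :=
    hg.fderiv_eq_zero_of_curve (hγ.prodMk hν) (by simp [hγt, hνt]) hmem
  have hline : ∀ a b : Vec n, HasDerivAt (fun s : ℂ => a + s • b) b 0 := fun a b => by
    simpa using ((hasDerivAt_id (0 : ℂ)).smul_const b).const_add a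
  -- The hyperplane `u` lies under `W`, so `X` may move along `p` with `u` fixed. Subtracting this
  -- from `(p, q)` leaves the vertical vector `(0, q)`.
  have h2 : fderiv ℂ g (X, u) (p, 0) = 0 := by
    refine hg.fderiv_eq_zero_of_curve ((hline X p).prodMk (hasDerivAt_const 0 u)) (by simp) ?_
    have h3 : ∀ᶠ s : ℂ in 𝓝 0, X + s • p ≠ 0 :=
      (hline X p).continuousAt.eventually_ne (by simpa using hX)
    filter_upwards [h3] with s hs
    exact hW _ hs (by simp [hXu, hp])
  have h3 : fderiv ℂ g (X, u) (0, u) = 0 := by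
    refine hg.fderiv_eq_zero_of_curve ((hasDerivAt_const 0 X).prodMk (hline u u)) (by simp) ?_
    have h4 : ∀ᶠ s : ℂ in 𝓝 0, 1 + s ≠ 0 := by
      have : ContinuousAt (fun s : ℂ => 1 + s) 0 := by fun_prop
      exact this.eventually_ne (by simp)
    filter_upwards [h4] with s hs
    have h5 := (smul_mem_bicone (A := W) one_ne_zero hs).2 hg.mem
    rwa [one_smul, add_smul, one_smul] at h5
  have h4 : fderiv ℂ g (X, u) (0, q) = 0 := by
    have : ((0, q) : Vec n × Vec n) = (p, q) - (p, 0) := by simp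
    rw [this, map_sub, h1, h2, sub_zero]
  set B := ((fderiv ℂ g (X, u)).comp (ContinuousLinearMap.inr ℂ (Vec n) (Vec n))).toLinearMap
  have hB : Function.Surjective B := hg.projects_onto_iff.1 hproj
  -- The vertical differential maps dimension `n + 1` onto dimension `n`, so its kernel is the line
  -- spanned by `u`.
  have hker : Module.finrank ℂ (LinearMap.ker B) = 1 := by
    have h5 := LinearMap.finrank_range_add_finrank_ker B
    rw [LinearMap.range_eq_top.2 hB, finrank_top, Module.finrank_fin_fun,
      Module.finrank_fin_fun] at h5
    omega
  have huB : u ∈ LinearMap.ker B := h3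
  have hqB : q ∈ LinearMap.ker B := h4
  obtain ⟨c, hc⟩ := (finrank_eq_one_iff_of_nonzero' (⟨u, huB⟩ : LinearMap.ker B)
    (by simpa using hu)).1 hker ⟨q, hqB⟩
  exact ⟨c, (congrArg Subtype.val hc).symm⟩

theorem analyticAt_partialDerivs {f : Vec n → ℂ} {X : Vec n} (hf : AnalyticAt ℂ f X) :
    AnalyticAt ℂ (partialDerivs f) X := by
  refine AnalyticAt.pi fun i => ?_
  exact ((ContinuousLinearMap.apply ℂ ℂ (Pi.single i 1 : Vec n)).analyticAt _).comp hf.fderiv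

/-- In a web whose fibers over `Proj n` consist of the hyperplanes of a fixed family, the
leaves are locally contained in their tangent hyperplanes. -/
theorem eventually_mem_tangent_hyperplane {W : Set (Proj n × Proj n)}
    (hWc : ∀ X u, (X, u) ∈ bicone W → u ⬝ᵥ X = 0 ∧
      ∀ Y, Y ≠ 0 → u ⬝ᵥ Y = 0 → (Y, u) ∈ bicone W)
    {f : Vec n → ℂ} {X : Vec n} (hf : AnalyticAt ℂ f X) (hf0 : fderiv ℂ f X ≠ 0) (hfX : f X = 0)
    (hfW : ∀ᶠ Y in 𝓝 X, f Y = 0 →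
      (Y, partialDerivs f Y) ∈ bicone W ∧ IsNoncritical W (Y, partialDerivs f Y)) :
    ∀ᶠ Y in 𝓝 X, f Y = 0 → partialDerivs f X ⬝ᵥ Y = 0 := by
  obtain ⟨ψ, χ, hψ0, hψd, hψdiff, hfψ, hχc, hχz, hψχ, hTχ⟩ :=
    exists_straightening hf (surjective_of_clm_ne_zero hf0) hfX
  obtain ⟨i, hi⟩ := Function.ne_iff.1 (hfW.self_of_nhds hfX).1.2.1
  change partialDerivs f X i ≠ 0 at hi
  have hψc : Tendsto ψ (𝓝 0) (𝓝 X) := by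
    have := hψd.continuousAt.tendsto
    rwa [hψ0] at this
  have hνc : ContinuousAt (fun Y => partialDerivs f Y i) X :=
    (continuous_apply i).continuousAt.comp (analyticAt_partialDerivs hf).continuousAt
  have hgood : ∀ᶠ k in 𝓝 (0 : Vec n), DifferentiableAt ℂ ψ k ∧
      (∀ᶠ k' in 𝓝 k, f (ψ k') = fderiv ℂ f X k') ∧ AnalyticAt ℂ f (ψ k) ∧
      partialDerivs f (ψ k) i ≠ 0 ∧ ∀ᶠ Y in 𝓝 (ψ k), f Y = 0 →
        (Y, partialDerivs f Y) ∈ bicone W ∧ IsNoncritical W (Y, partialDerivs f Y) := by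
    filter_upwards [hψdiff, hfψ.eventually_nhds, hψc.eventually hf.eventually_analyticAt,
      hψc.eventually (hνc.eventually_ne hi), hψc.eventually hfW.eventually_nhds]
      with k h1 h2 h3 h4 h5
    exact ⟨h1, h2, h3, h4, h5⟩
  obtain ⟨ε, hε, hball⟩ := Metric.eventually_nhds_iff_ball.1 hgood
  have hχ' : Tendsto χ (𝓝 X) (𝓝 0) := by simpa [ContinuousAt, hχz] using hχc
  filter_upwards [hψχ, hTχ, hχ'.eventually (Metric.ball_mem_nhds 0 hε)] with Y hY1 hY2 hY3 hfY
  set k := χ Y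
  have hTk : fderiv ℂ f X k = 0 := by rw [hY2, hfY]
  set s : Set ℂ := (fun t : ℂ => t • k) ⁻¹' Metric.ball 0 ε
  have hs : IsOpen s := Metric.isOpen_ball.preimage (by fun_prop)
  have hsc : IsPreconnected s :=
    ((convex_ball (0 : Vec n) ε).linear_preimage
      ((LinearMap.toSpanSingleton ℂ (Vec n) k).restrictScalars ℝ)).isPreconnected
  -- These ratios are affine coordinates of the tangent hyperplane. Along the path the covector has
  -- derivative proportional to itself, so each quotient has derivative zero.
  have hderiv : ∀ j, ∀ t ∈ s, HasDerivAt
      (fun t : ℂ => partialDerivs f (ψ (t • k)) j / partialDerivs f (ψ (t • k)) i) 0 t := by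
    intro j t ht
    obtain ⟨h1, h2, h3, h4, h5⟩ := hball (t • k) ht
    have hl : HasDerivAt (fun t : ℂ => t • k) k t := by
      simpa using (hasDerivAt_id t).smul_const k
    have hγ : HasDerivAt (fun t : ℂ => ψ (t • k)) (fderiv ℂ ψ (t • k) k) t :=
      HasFDerivAt.comp_hasDerivAt (f := fun t : ℂ => t • k) t h1.hasFDerivAt hl
    have hfγ : ∀ᶠ r in 𝓝 t, f (ψ (r • k)) = 0 := by
      filter_upwards [hl.continuousAt.eventually h2] with r hr
      rw [hr, map_smul, hTk, smul_zero]
    have hp : partialDerivs f (ψ (t • k)) ⬝ᵥ fderiv ℂ ψ (t • k) k = 0 := by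
      rw [← fderiv_eq_partialDerivs]
      have h6 : HasDerivAt (fun t : ℂ => f (ψ (t • k)))
          (fderiv ℂ f (ψ (t • k)) (fderiv ℂ ψ (t • k) k)) t :=
        HasFDerivAt.comp_hasDerivAt (f := fun t : ℂ => ψ (t • k)) t
          h3.differentiableAt.hasFDerivAt hγ
      exact h6.unique ((hasDerivAt_const t (0 : ℂ)).congr_of_eventuallyEq hfγ)
    have hν := HasFDerivAt.comp_hasDerivAt (f := fun t : ℂ => ψ (t • k)) t
      (analyticAt_partialDerivs h3).differentiableAt.hasFDerivAt hγ
    obtain ⟨hmem, hnc⟩ := h5.self_of_nhds hfγ.self_of_nhds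
    obtain ⟨hcontact, hconst⟩ := hWc _ _ hmem
    obtain ⟨c, hc⟩ := hnc.eq_smul_of_curve hconst hcontact hp hγ hν rfl rfl (by
      filter_upwards [hfγ, hγ.continuousAt.eventually h5] with r h6 h7
      exact (h7 h6).1)
    rw [hc] at hν
    have hνj := hasDerivAt_pi.1 hν
    refine ((hνj j).div (hνj i) h4).congr_deriv ?_
    simp only [Pi.smul_apply, smul_eq_mul, Function.comp_apply]
    rw [div_eq_zero_iff]
    left
    ring
  have h1s : (1 : ℂ) ∈ s := by simpa [s] using hY3
  have h0s : (0 : ℂ) ∈ s := by simpa [s] using hε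
  have hconst : ∀ j, partialDerivs f Y j / partialDerivs f Y i =
      partialDerivs f X j / partialDerivs f X i := by
    intro j
    have := hs.is_const_of_deriv_eq_zero hsc
      (fun t ht => (hderiv j t ht).differentiableAt.differentiableWithinAt)
      (fun t ht => (hderiv j t ht).deriv) h1s h0s
    simpa [hY1, hψ0] using this
  obtain ⟨-, -, -, hYi, hYW⟩ := hball k (by simpa using hY3)
  rw [hY1] at hYi hYW
  have hYX : partialDerivs f X = (partialDerivs f X i / partialDerivs f Y i) •
      partialDerivs f Y := by
    ext j
    have := hconst j
    rw [div_eq_div_iff hYi hi] at this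
    simp only [Pi.smul_apply, smul_eq_mul]
    rw [div_mul_eq_mul_div, eq_div_iff hYi]
    linear_combination -this
  rw [hYX, smul_dotProduct, (hWc _ _ (hYW.self_of_nhds hfY).1).1, smul_zero]

/-- In a web whose fibers over `Proj n` consist of the hyperplanes of a fixed family, every
connected leaf is contained in a hyperplane of this family. -/
theorem IsLocallyLeaf.exists_subset_hyperplane {W : Set (Proj n × Proj n)}
    (hWc : ∀ X u, (X, u) ∈ bicone W → u ⬝ᵥ X = 0 ∧
      ∀ Y, Y ≠ 0 → u ⬝ᵥ Y = 0 → (Y, u) ∈ bicone W)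
    {L : Set (Proj n)} (hLr : L ⊆ regularPart W) (hLc : IsConnected L) (hL : IsLocallyLeaf W L) :
    ∃ w ∈ W, L ⊆ hyperplane w.2 := by
  have hmem : ∀ {m : Proj n} {u : Vec n} (hu : u ≠ 0), (∀ᶠ m' in 𝓝 m, m' ∈ L →
      m' ∈ hyperplane (Projectivization.mk ℂ u hu)) ↔
      ∀ᶠ Y in 𝓝 m.rep, Y ∈ cone L → u ⬝ᵥ Y = 0 := by
    intro m u hu
    conv_lhs => rw [← m.mk_rep]
    rw [eventually_nhds_mk m.rep_nonzero]
    refine eventually_congr (.of_forall fun Y => ?_)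
    constructor
    · rintro h ⟨hY, hYL⟩
      exact (mem_cone_hyperplane hY hu).1 ((mem_cone_mk hY).2 (h hY hYL))
    · intro h hY hYL
      exact (mem_cone_mk hY).1 ((mem_cone_hyperplane hY hu).2 (h ⟨hY, hYL⟩))
  have hex : ∀ m ∈ L, ∃ f : Vec n → ℂ, AnalyticAt ℂ f m.rep ∧ fderiv ℂ f m.rep ≠ 0 ∧
      f m.rep = 0 ∧ (∀ᶠ Y in 𝓝 m.rep, (Y ∈ cone L ↔ f Y = 0)) ∧
      (m.rep, partialDerivs f m.rep) ∈ bicone W ∧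
      ∀ᶠ Y in 𝓝 m.rep, f Y = 0 → partialDerivs f m.rep ⬝ᵥ Y = 0 := by
    intro m hm
    obtain ⟨f, hf, hf0, hfL, hfW⟩ := hL m.rep (rep_mem_cone.2 ⟨hm, hLr hm⟩)
    have hfm : f m.rep = 0 := hfL.self_of_nhds.1 (rep_mem_cone.2 hm)
    refine ⟨f, hf, hf0, hfm, hfL, hfW.self_of_nhds hfm,
      eventually_mem_tangent_hyperplane hWc hf hf0 hfm ?_⟩
    filter_upwards [hfL, hfW] with Y h1 h2 h3
    obtain ⟨hY, hYL⟩ := h1.2 h3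
    exact ⟨h2 h3, (mk_mem_regularPart hY).1 (hLr hYL) _ (h2 h3)⟩
  have hcov : ∀ m ∈ L, ∃ h, (m, h) ∈ W ∧ ∀ᶠ m' in 𝓝 m, m' ∈ L → m' ∈ hyperplane h := by
    intro m hm
    obtain ⟨f, -, -, -, hfL, hfW, hft⟩ := hex m hm
    refine ⟨Projectivization.mk ℂ _ hfW.2.1, ?_, (hmem hfW.2.1).2 ?_⟩
    · rw [← rep_mem_bicone]
      obtain ⟨a, ha, hr⟩ := exists_rep_eq_smul hfW.2.1
      rw [hr]
      simpa using (smul_mem_bicone one_ne_zero ha).2 hfW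
    · filter_upwards [hfL, hft] with Y h1 h2 h3
      exact h2 (h1.1 h3)
  have huniq : ∀ m ∈ L, ∀ h h' : Proj n, (∀ᶠ m' in 𝓝 m, m' ∈ L → m' ∈ hyperplane h) →
      (∀ᶠ m' in 𝓝 m, m' ∈ L → m' ∈ hyperplane h') → h = h' := by
    intro m hm h h' hh hh'
    obtain ⟨f, hf, hf0, hfm, hfL, -⟩ := hex m hm
    have key : ∀ h : Proj n, (∀ᶠ m' in 𝓝 m, m' ∈ L → m' ∈ hyperplane h) →
        ∃ c : ℂ, h.rep = c • partialDerivs f m.rep := by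
      intro h hh
      rw [← h.mk_rep, hmem h.rep_nonzero] at hh
      refine eq_smul_partialDerivs hf hf0 hfm ?_
      filter_upwards [hfL, hh] with Y h1 h2 h3
      exact h2 (h1.2 h3)
    obtain ⟨c, hc⟩ := key h hh
    obtain ⟨c', hc'⟩ := key h' hh'
    have hc0 : c' ≠ 0 := by
      rintro rfl
      exact h'.rep_nonzero (by rw [hc', zero_smul])
    rw [← h.mk_rep, ← h'.mk_rep, Projectivization.mk_eq_mk_iff']
    exact ⟨c * c'⁻¹, by rw [hc, hc', smul_smul, mul_assoc, inv_mul_cancel₀ hc0, mul_one]⟩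
  obtain ⟨m₀, hm₀⟩ := hLc.nonempty
  obtain ⟨h₀, hw₀, hh₀⟩ := hcov m₀ hm₀
  refine ⟨(m₀, h₀), hw₀, ?_⟩
  -- The sets `U h` are open, cover `L`, and are disjoint on `L` because the tangent hyperplane is
  -- unique. Connectedness leaves only one of them.
  set U : Proj n → Set (Proj n) := fun h => {m | ∀ᶠ m' in 𝓝 m, m' ∈ L → m' ∈ hyperplane h}
  have hU : ∀ h, IsOpen (U h) := fun h => isOpen_setOfPred_eventually_nhds
  intro m hm
  by_contra hcon
  obtain ⟨h, -, hh⟩ := hcov m hm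
  have hne : h ≠ h₀ := by
    rintro rfl
    exact hcon (hh.self_of_nhds hm)
  obtain ⟨m₁, hm₁, hU₁, hV₁⟩ := hLc.isPreconnected (U h₀) (⋃ h ∈ ({h₀}ᶜ : Set (Proj n)), U h)
    (hU h₀) (isOpen_biUnion fun h _ => hU h) (fun m' hm' => by
      obtain ⟨h', -, hh'⟩ := hcov m' hm'
      by_cases heq : h' = h₀
      · subst heq; exact Or.inl hh'
      · exact Or.inr (Set.mem_biUnion heq hh')) ⟨m₀, hm₀, hh₀⟩ ⟨m, hm, Set.mem_biUnion hne hh⟩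
  obtain ⟨h', hh', hU'⟩ := Set.mem_iUnion₂.1 hV₁
  exact hh' (huniq m₁ hm₁ h' h₀ hU' hU₁)

/-! ### Multi-degree zero and the dual curve -/

theorem GlobalPDE.evalAt_eq_of_degree_zero {S : GlobalPDE n} (hS : S.δ = 0) (X u : Vec n) :
    evalAt S.H (X, u) = evalAt S.H (0, u) := by
  -- Scaling by `0` is allowed: for `δ = 0` the factor is `0 ^ 0 = 1`.
  have h := S.evalAt_smul_left 0 X u
  rw [hS, pow_zero, one_mul, zero_smul] at h
  exact h.symm

/-- The polynomial in `u` obtained by setting `X = 0`. -/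
noncomputable def GlobalPDE.dualPolynomial (S : GlobalPDE n) : MvPolynomial (Fin (n + 1)) ℂ :=
  MvPolynomial.aeval (Sum.elim (fun _ => 0) MvPolynomial.X) S.H

theorem GlobalPDE.eval_dualPolynomial (S : GlobalPDE n) (u : Vec n) :
    MvPolynomial.eval u S.dualPolynomial = evalAt S.H (0, u) := by
  have h := MvPolynomial.comp_aeval_apply (R := ℂ)
    (Sum.elim (fun _ => 0) MvPolynomial.X : Fin (n + 1) ⊕ Fin (n + 1) →
      MvPolynomial (Fin (n + 1)) ℂ) (MvPolynomial.aeval u) S.H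
  have h2 : (fun i => MvPolynomial.aeval u ((Sum.elim (fun _ => 0) MvPolynomial.X :
      Fin (n + 1) ⊕ Fin (n + 1) → MvPolynomial (Fin (n + 1)) ℂ) i)) = Sum.elim (0 : Vec n) u := by
    funext i
    rcases i with i | i <;> simp
  rw [h2] at h
  exact h

theorem GlobalPDE.isHomogeneous_dualPolynomial (S : GlobalPDE n) :
    S.dualPolynomial.IsHomogeneous S.d := by
  rw [dualPolynomial, MvPolynomial.aeval_def, MvPolynomial.eval₂_eq']
  refine MvPolynomial.IsHomogeneous.sum _ _ _ fun m hm => ?_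
  have hw := S.homogeneous_right (MvPolynomial.mem_support_iff.1 hm)
  rw [Finsupp.weight_apply, Finsupp.sum_fintype _ _ (by simp), Fintype.sum_sum_type] at hw
  simp only [Sum.elim_inl, Sum.elim_inr, smul_eq_mul, mul_zero, mul_one, Finset.sum_const_zero,
    zero_add] at hw
  have h1 : (∏ i, (Sum.elim (fun _ => 0) MvPolynomial.X : Fin (n + 1) ⊕ Fin (n + 1) →
      MvPolynomial (Fin (n + 1)) ℂ) i ^ m i).IsHomogeneous
      (∑ i, (Sum.elim (fun _ => 0) (fun _ => 1) : Fin (n + 1) ⊕ Fin (n + 1) → ℕ) i * m i) := by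
    refine MvPolynomial.IsHomogeneous.prod _ _ _ fun i _ => ?_
    rcases i with i | i
    -- The zero polynomial is taken as homogeneous of degree `0`, matching the weight of the `X`
    -- variables.
    · exact (MvPolynomial.isHomogeneous_zero (Fin (n + 1)) ℂ 0).pow (m (Sum.inl i))
    · exact (MvPolynomial.isHomogeneous_X ℂ i).pow (m (Sum.inr i))
  have h2 := (MvPolynomial.isHomogeneous_C (Fin (n + 1)) (MvPolynomial.coeff m S.H)).mul h1
  rw [Fintype.sum_sum_type] at h2
  simp only [Sum.elim_inl, Sum.elim_inr, zero_mul, one_mul, Finset.sum_const_zero, zero_add,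
    hw] at h2
  exact h2

/-- The algebraic set of the dual projective space defined by PDEs of bi-degrees `(0, d_α)`. -/
def dualCurve (S : Fin (n - 1) → GlobalPDE n) : Set (Proj n) :=
  {h | ∀ p ∈ Set.range fun α => (S α).dualPolynomial, MvPolynomial.eval h.rep p = 0}

theorem mem_cone_dualCurve (S : Fin (n - 1) → GlobalPDE n) {u : Vec n} (hu : u ≠ 0) :
    u ∈ cone (dualCurve S) ↔ ∀ α, evalAt (S α).H (0, u) = 0 := by
  have hs : ∀ p ∈ Set.range fun α => (S α).dualPolynomial, ∃ k, p.IsHomogeneous k := by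
    rintro p ⟨α, rfl⟩
    exact ⟨_, (S α).isHomogeneous_dualPolynomial⟩
  rw [mem_cone_mk hu, dualCurve, mk_mem_zeroLocus hs hu]
  simp [GlobalPDE.eval_dualPolynomial]

section DegreeZero

variable {W : Set (Proj n × Proj n)} {S : Fin (n - 1) → GlobalPDE n}

theorem IsCIWeb.mem_bicone_iff_dualCurve (hW : IsCIWeb W S) (hS : ∀ α, (S α).δ = 0) {X u : Vec n}
    (hX : X ≠ 0) (hu : u ≠ 0) : (X, u) ∈ bicone W ↔ u ⬝ᵥ X = 0 ∧ u ∈ cone (dualCurve S) := by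
  rw [hW.mem_bicone hX hu, mem_cone_dualCurve S hu]
  simp only [GlobalPDE.evalAt_eq_of_degree_zero (hS _) X u]

/-- On the tangent space of the contact cone, a hyperplane of directions, the rank `n` differential
of `g` factors through that of the `n - 1` equations in `u`. Hence the latter has rank at least `n -
1`, so it is surjective. -/
theorem IsCIWeb.isRegularPoint_dualCurve (hW : IsCIWeb W S) (hS : ∀ α, (S α).δ = 0)
    {z : Vec n × Vec n} (hz : IsRegularPoint (bicone W) n z) :
    IsRegularPoint (cone (dualCurve S)) (n - 1) z.2 := by
  obtain ⟨g, hg⟩ := hz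
  have hX := hg.mem.1
  have hu := hg.mem.2.1
  obtain ⟨huX, huC⟩ := (hW.mem_bicone_iff_dualCurve hS hX hu).1 hg.mem
  have hGa : ∀ α, AnalyticAt ℂ (fun v : Vec n => evalAt (S α).H (0, v)) z.2 := fun α =>
    (analyticAt_evalAt (S α).H (0, z.2)).comp_of_eq (f := fun v : Vec n => ((0 : Vec n), v))
      (analyticAt_const.prod analyticAt_id) rfl
  set G : Vec n → Fin (n - 1) → ℂ := fun v α => evalAt (S α).H (0, v) with hG
  have hGan : AnalyticAt ℂ G z.2 := AnalyticAt.pi hGa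
  have hHd : ∀ α a, fderiv ℂ (evalAt (S α).H) z a = fderiv ℂ G z.2 a.2 α := by
    intro α a
    have h1 : evalAt (S α).H = (fun v : Vec n => evalAt (S α).H (0, v)) ∘ Prod.snd :=
      funext fun y => (S α).evalAt_eq_of_degree_zero (hS α) y.1 y.2
    rw [h1, (HasFDerivAt.comp z (hGa α).differentiableAt.hasFDerivAt hasFDerivAt_snd).fderiv,
      fderiv_pi fun α => (hGa α).differentiableAt]
    rfl
  have hgerm : ∀ j, GermVanishesOn (bicone W) z (fun y => g y j) := fun j => by
    refine ⟨((ContinuousLinearMap.proj (R := ℂ) (φ := fun _ : Fin n => ℂ) j).analyticAt _).comp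
      hg.analyticAt, ?_⟩
    filter_upwards [hg.mem_iff] with y h1 h2
    rw [h1.1 h2]
    rfl
  choose b hb using fun j => hW.exists_fderiv_eq_sum hg.mem (hgerm j)
  have hgd : ∀ a : Vec n × Vec n, z.2 ⬝ᵥ a.1 + a.2 ⬝ᵥ z.1 = 0 →
      fderiv ℂ g z a = Matrix.mulVecLin (Matrix.of b) (fderiv ℂ G z.2 a.2) := by
    intro a ha
    ext j
    have h1 := hb j a ha
    rw [fderiv_apply hg.analyticAt.differentiableAt] at h1
    simp only [hHd] at h1
    exact h1
  refine ⟨G, huC, hGan, ?_, ?_⟩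
  · obtain ⟨e, he⟩ := exists_dotProduct_eq_one hu
    set R := LinearMap.range (fderiv ℂ G z.2).toLinearMap with hR
    -- The direction `(e, 0)` is transverse to the contact cone; it accounts for the one dimension
    -- not controlled by `hgd`.
    have htop : (⊤ : Submodule ℂ (Fin n → ℂ)) ≤
        R.map (Matrix.mulVecLin (Matrix.of b)) ⊔ ℂ ∙ fderiv ℂ g z (e, 0) := by
      intro y _
      obtain ⟨a, rfl⟩ := hg.surjective y
      have h1 : a = (a - (z.2 ⬝ᵥ a.1 + a.2 ⬝ᵥ z.1) • (e, 0)) +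
          (z.2 ⬝ᵥ a.1 + a.2 ⬝ᵥ z.1) • (e, 0) := by simp
      rw [h1, map_add, map_smul]
      refine Submodule.add_mem_sup ?_ (Submodule.smul_mem _ _ (Submodule.mem_span_singleton_self _))
      rw [hgd _ (by simp [he])]
      exact Submodule.mem_map_of_mem (LinearMap.mem_range_self _ _)
    have h2 := Submodule.finrank_mono htop
    rw [finrank_top, Module.finrank_fin_fun] at h2
    have h3 := Submodule.finrank_add_le_finrank_add_finrank
      (R.map (Matrix.mulVecLin (Matrix.of b))) (ℂ ∙ fderiv ℂ g z (e, 0))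
    have h4 := Submodule.finrank_map_le (Matrix.mulVecLin (Matrix.of b)) R
    have h5 : Module.finrank ℂ (ℂ ∙ fderiv ℂ g z (e, 0)) ≤ 1 := by
      simpa using finrank_span_le_card (R := ℂ) {fderiv ℂ g z (e, 0)}
    have h6 := Submodule.finrank_le R
    have h7 : R = ⊤ := by
      refine Submodule.eq_top_of_finrank_eq ?_
      rw [Module.finrank_fin_fun] at h6 ⊢
      omega
    exact LinearMap.range_eq_top.1 h7
  · filter_upwards [isOpen_ne.mem_nhds hu] with v hv
    rw [mem_cone_dualCurve S hv, funext_iff]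
    rfl

theorem exists_ne_zero_dotProduct_eq_zero (hn : 1 ≤ n) (u : Vec n) :
    ∃ X : Vec n, X ≠ 0 ∧ u ⬝ᵥ X = 0 := by
  have h1 := LinearMap.finrank_range_add_finrank_ker (linearForm u).toLinearMap
  have h2 := Submodule.finrank_le (LinearMap.range (linearForm u).toLinearMap)
  rw [Module.finrank_self] at h2
  rw [Module.finrank_fin_fun] at h1
  have : Nontrivial (LinearMap.ker (linearForm u).toLinearMap) :=
    Module.nontrivial_of_finrank_pos (R := ℂ) (by omega)
  obtain ⟨X, hX⟩ := exists_ne (0 : LinearMap.ker (linearForm u).toLinearMap)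
  exact ⟨X, by simpa using hX, by rw [← linearForm_apply]; exact X.2⟩

/-- Density of regular points passes from `W` to the curve through the continuous second projection.
The regular part of `W` serves as the generic set of hyperplanes of the dual space, since the fiber
above `m` is the section of the curve by `m`. -/
theorem IsCIWeb.isAlgebraicCurve_dualCurve (hW : IsCIWeb W S) (hS : ∀ α, (S α).δ = 0) :
    IsAlgebraicCurve (dualCurve S) (∏ α, (S α).d) := by
  have hn := one_le_of_isWeb hW.isWeb
  refine ⟨⟨_, ?_, rfl⟩, ?_, regularPart W, isOpen_regularPart hW.isWeb.analytic,
    dense_regularPart hn hW.isWeb.critical_dim, fun m hm => ?_⟩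
  · rintro p ⟨α, rfl⟩
    exact ⟨_, (S α).isHomogeneous_dualPolynomial⟩
  · intro u huC
    obtain ⟨X, hX, huX⟩ := exists_ne_zero_dotProduct_eq_zero hn u
    have h1 := hW.isWeb.pureDim ((hW.mem_bicone_iff_dualCurve hS hX huC.1).2 ⟨huX, huC⟩)
    refine closure_mono ?_ (image_closure_subset_closure_image continuous_snd ⟨_, h1, rfl⟩)
    rintro v ⟨z, hz, rfl⟩
    exact hW.isRegularPoint_dualCurve hS hz
  · rw [← hW.isWeb.sheets m hm]
    congr 1
    ext h
    have h1 := hW.mem_bicone_iff_dualCurve hS m.rep_nonzero h.rep_nonzero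
    rw [rep_mem_bicone, rep_mem_cone, ← mem_cone_hyperplane m.rep_nonzero h.rep_nonzero,
      rep_mem_cone, h.mk_rep] at h1
    exact and_comm.trans h1.symm

/-- A complete intersection web of multi-degree zero is algebraic. -/
theorem IsCIWeb.isAlgebraicWeb (hW : IsCIWeb W S) (hS : ∀ α, (S α).δ = 0) :
    IsAlgebraicWeb W (∏ α, (S α).d) := by
  refine ⟨hW.isWeb, dualCurve S, hW.isAlgebraicCurve_dualCurve hS, ?_, ?_⟩
  · intro L hLr hLc hL
    have hWc : ∀ X u, (X, u) ∈ bicone W → u ⬝ᵥ X = 0 ∧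
        ∀ Y, Y ≠ 0 → u ⬝ᵥ Y = 0 → (Y, u) ∈ bicone W := by
      intro X u hXu
      have hu := hXu.2.1
      obtain ⟨h1, h2⟩ := (hW.mem_bicone_iff_dualCurve hS hXu.1 hu).1 hXu
      exact ⟨h1, fun Y hY huY => (hW.mem_bicone_iff_dualCurve hS hY hu).2 ⟨huY, h2⟩⟩
    obtain ⟨⟨m, h⟩, hw, hLh⟩ := hL.exists_subset_hyperplane hWc hLr hLc
    refine ⟨h, ?_, hLh⟩
    exact rep_mem_cone.1 ((hW.mem_bicone_iff_dualCurve hS m.rep_nonzero h.rep_nonzero).1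
      (rep_mem_bicone.2 hw)).2
  · rintro h hh X ⟨hX, hXh, -⟩
    have hu := h.rep_nonzero
    have hcone : ∀ Y : Vec n, Y ≠ 0 → (Y ∈ cone (hyperplane h) ↔ h.rep ⬝ᵥ Y = 0) := by
      intro Y hY
      rw [← mem_cone_hyperplane hY hu, h.mk_rep]
    have hlin : (fun Y : Vec n => h.rep ⬝ᵥ Y) = linearForm h.rep :=
      funext fun Y => (linearForm_apply _ Y).symm
    refine ⟨fun Y => h.rep ⬝ᵥ Y, ?_, ?_, ?_, ?_⟩
    · rw [hlin]; exact (linearForm h.rep).analyticAt X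
    · rw [hlin, ContinuousLinearMap.fderiv]
      obtain ⟨e, he⟩ := exists_dotProduct_eq_one hu
      intro h0
      rw [← linearForm_apply, h0] at he
      exact zero_ne_one he
    · filter_upwards [isOpen_ne.mem_nhds hX] with Y hY using hcone Y hY
    · filter_upwards [isOpen_ne.mem_nhds hX] with Y hY hYh
      rw [partialDerivs_dotProduct, hW.mem_bicone_iff_dualCurve hS hY hu]
      exact ⟨hYh, rep_mem_cone.2 hh⟩

end DegreeZero

end Webs

theorem proposition6p11 (n : ℕ) (W : Set (Webs.Proj n × Webs.Proj n))
    (S : Fin (n - 1) → Webs.GlobalPDE n) (hW : Webs.IsCIWeb W S) :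
    (Webs.IsAlgebraicWeb W (∏ α, (S α).d) ↔ Webs.multidegree S = 0) ∧
    (Webs.IsAlgebraicWeb W (∏ α, (S α).d) ↔ ∀ α, (S α).bidegree = (0, (S α).d)) := by
  have h1 : Webs.IsAlgebraicWeb W (∏ α, (S α).d) ↔ Webs.multidegree S = 0 :=
    ⟨hW.multidegree_eq_zero, fun h => hW.isAlgebraicWeb fun α => congrFun h α⟩
  refine ⟨h1, h1.trans ?_⟩
  simp [funext_iff, Webs.multidegree, Webs.GlobalPDE.bidegree]
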